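/- Let $n=2p>2$ be even, let $0\le p^*\le p$ and $c_1,\dots,c_{p^*},\xi_1,\dots,\xi_{p^*}\in\mathbb C$, and put $s_k=\sum_{j=1}^{p^*}c_j\xi_j^k$ for $k=0,\dots,n-1$. For $j\in\{1,\dots,p\}$, $z\in\mathbb C$, $\zeta^{(j)}=(\zeta_h)_{h\ne j}\in\mathbb C^{p-1}$ and $\gamma\in\mathbb C^p$ let $x_h=\zeta_h$ for $h\neq j$, $x_j=z$, and $$J(\zeta^{(j)},z,\gamma)=(-1)^{p}\prod_{i=1}^p\gamma_i\prod_{r<h;\ r,h\ne j}(\zeta_r-\zeta_h)^4\prod_{r\ne j}(\zeta_r-z)^4 .$$ For $\sigma>0$ define (integrals with respect to Lebesgue measure on real and imaginary parts) $$h_n^{(j)}(z,\sigma)=\frac1{(\pi\sigma^2)^n}\int_{\mathbb C^{p-1}}\int_{\mathbb C^{p}}|J(\zeta^{(j)},z,\gamma)|^2\exp\Big(-\frac1{\sigma^2}\sum_{k=0}^{n-1}\Big|\sum_{h=1}^p\gamma_hx_h^k-s_k\Big|^2\Big)\,d\gamma\,d\zeta^{(j)},\qquad h_n(z,\sigma)=\frac2n\sum_{j=1}^{p}h_n^{(j)}(z,\sigma).$$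 Let $X_j$ be the $p\times n$ matrix with entries $\overline{x_h}^{\,k}$ ($1\le h\le p$, $0\le k\le n-1$), $Q_j=X_jX_j^H$, $\mu_j=Q_j^{-1}X_js$, $\tilde Q_j=\begin{pmatrix}\Re Q_j&-\Im Q_j\\ \Im Q_j&\Re Q_j\end{pmatrix}$, $D_j=\det\tilde Q_j$, and, when $D_j\neq0$, let $$f_j(\zeta^{(j)},z,\sigma)=E\Big[\prod_{i=1}^p(g_i^2+g_{p+i}^2)\Big],\qquad g\sim N\big(\tilde\mu_j,\tfrac{\sigma^2}{2}\tilde Q_j^{-1}\big),$$ where $\tilde\mu_j\in\mathbb R^n$ stacks $\Re\mu_j$ and $\Im\mu_j$. Let $\beta_0,\dots,\beta_{p}$ (functions of $\zeta^{(j)},z$, and a priori of $s$) be the coefficients of the expansion $$f_j(\zeta^{(j)},z,\sigma)=\sum_{h=0}^{p}\beta_h\frac{\sigma^{2h}}{2^hD_j^{\,n-h}}\qquad(\sigma>0).$$ Then, wherever $D_j\ne0$, these coefficients exist, are unique, and $\beta_{n/2}$ does not depend on $s$; all the integrals above and below converge absolutely; and for every $j$ and every $z\in\mathbb C$, $$\lim_{\sigma\to\infty}h_n^{(j)}(z,\sigma)=H(z):=\frac1{(2\pi)^{n/2}}\int_{\mathbb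 C^{p-1}}\beta_{n/2}(\zeta^{(1)},z)\,\frac{\prod_{r<h;\ r,h\ne1}|\zeta_r-\zeta_h|^8\prod_{r\ne1}|\zeta_r-z|^8}{D_1(\zeta^{(1)},z)^{\frac{n+1}{2}}}\,d\zeta^{(1)},$$ a function which depends neither on $j$ nor on $s$. Moreover, if $s=0$ (which for pairwise distinct $\xi_j$ is equivalent to $c=0$), then $h_n(z,\sigma)=h_n^{(j)}(z,\sigma)=H(z)$ for all $j$, $z$ and $\sigma>0$. In this case $H/(n/2)!$ is the condensed density of pure noise: if $\epsilon_0,\dots,\epsilon_{n-1}$ are independent random variables with density $(\pi\sigma^2)^{-1}e^{-|w|^2/\sigma^2}$ on $\mathbb C$, $d_k=s_k+\epsilon_k=\epsilon_k$, $U_0=(d_{a+b})_{0\le a,b<p}$ and $U_1=(d_{a+b+1})_{0\le a,b<p}$, then $H/(n/2)!$ is a nonnegative measurable function and, for every Borel set $A\subset\mathbb C$, the expected number of generalized eigenvalues of $(U_1,U_0)$ (roots $z$ of $\det(U_1-zU_0)$, with multiplicity) lying in $A$, divided by $p$, equals $\int_A H(z)/(n/2)!\,dz$. Finally, $H(z)$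 depends only on $|z|^2$. -/

import Mathlib

open MeasureTheory ProbabilityTheory Filter Topology

/-! Throughout, `n = 2 * p`; indices `1, …, n/2` are `Fin p`, sample indices `0, …, n - 1` are
`Fin (2 * p)`. -/

section

/-! ### Signal, Hankel pencil, and condensed density of its generalized eigenvalues -/

/-- The noiseless samples `s_k = ∑_j c_j ξ_j ^ k`, `k = 0, …, n - 1`. -/
noncomputable def expSignal (p : ℕ) {q : ℕ} (c ξ : Fin q → ℂ) : Fin (2 * p) → ℂ :=
  fun k => ∑ j, c j * ξ j ^ (k : ℕ)

/-- Hankel matrix with entries `d_{a+b}`, `0 ≤ a, b < p`. -/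
def hankelZero {p : ℕ} (d : Fin (2 * p) → ℂ) : Matrix (Fin p) (Fin p) ℂ :=
  Matrix.of fun a b => d ⟨a + b, by omega⟩

/-- Hankel matrix with entries `d_{a+b+1}`, `0 ≤ a, b < p`. -/
def hankelOne {p : ℕ} (d : Fin (2 * p) → ℂ) : Matrix (Fin p) (Fin p) ℂ :=
  Matrix.of fun a b => d ⟨a + b + 1, by omega⟩

/-- Generalized eigenvalues of the pencil `(U₁, U₀)`: the roots, with multiplicity,
of `det (U₁ - X U₀)`. -/
noncomputable def generalizedEigenvalues {p : ℕ} (U₁ U₀ : Matrix (Fin p) (Fin p) ℂ) :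
    Multiset ℂ :=
  (U₁.map Polynomial.C - (Polynomial.X : Polynomial ℂ) • U₀.map Polynomial.C).det.roots

/-- Centred circular complex Gaussian law with `E |ε|² = σ²`, i.e. with density
`(π σ²)⁻¹ exp (-|w|² / σ²)`. -/
noncomputable def complexGaussian (σ : ℝ) : Measure ℂ :=
  volume.withDensity fun w =>
    ENNReal.ofReal (1 / (Real.pi * σ ^ 2) * Real.exp (-(1 / σ ^ 2) * ‖w‖ ^ 2))

/-- `h` is the density of the expected normalized counting measure
`A ↦ (1/p) E [∑_j δ_{ξ_j}(A)]` of the generalized eigenvalues `ξ_1, …, ξ_p` of the random Hankel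
pencil built on the random samples `d`. -/
def IsCondensedDensity {p : ℕ} {Ω : Type*} [MeasurableSpace Ω] (P : Measure Ω)
    (d : Ω → Fin (2 * p) → ℂ) (h : ℂ → ℝ) : Prop :=
  Measurable h ∧ (∀ z, 0 ≤ h z) ∧
    ∀ A : Set ℂ, MeasurableSet A →
      ∫⁻ z in A, ENNReal.ofReal (h z) =
        (p : ENNReal)⁻¹ *
          ∫⁻ ω, ((generalizedEigenvalues (hankelOne (d ω)) (hankelZero (d ω))).map
            (fun x => Measure.dirac x)).sum A ∂P

/-! ### The functions `h_n^{(j)}` -/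

/-- The vector of nodes: `z` in position `j`, and `ζ` in the other positions. -/
def nodes {p : ℕ} (j : Fin p) (ζ : {h : Fin p // h ≠ j} → ℂ) (z : ℂ) : Fin p → ℂ :=
  fun h => if hj : h = j then z else ζ ⟨h, hj⟩

/-- `J_C^*(ζ^{(j)}, z, γ)` for `n ≥ 4`. -/
noncomputable def jacobianC {p : ℕ} (j : Fin p) (ζ : {h : Fin p // h ≠ j} → ℂ) (z : ℂ)
    (γ : Fin p → ℂ) : ℂ :=
  (-1) ^ p * (∏ i, γ i) *
    (∏ q : {h : Fin p // h ≠ j} × {h : Fin p // h ≠ j} with q.1 < q.2, (ζ q.1 - ζ q.2) ^ 4) *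
    ∏ r, (ζ r - z) ^ 4

/-- The integrand defining `h_n^{(j)}`; the Jacobian with respect to real and imaginary parts is
`|J_C^*|²`. -/
noncomputable def marginalIntegrand {p : ℕ} (j : Fin p) (s : Fin (2 * p) → ℂ) (z : ℂ) (σ : ℝ)
    (ζ : {h : Fin p // h ≠ j} → ℂ) (γ : Fin p → ℂ) : ℝ :=
  ‖jacobianC j ζ z γ‖ ^ 2 *
    Real.exp (-(1 / σ ^ 2) * ∑ k : Fin (2 * p),
      ‖∑ h, γ h * nodes j ζ z h ^ (k : ℕ) - s k‖ ^ 2)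

/-- `h_n^{(j)}(z, σ)`, for the noiseless samples `s`. -/
noncomputable def marginalDensity {p : ℕ} (j : Fin p) (s : Fin (2 * p) → ℂ) (z : ℂ) (σ : ℝ) : ℝ :=
  1 / (Real.pi * σ ^ 2) ^ (2 * p) *
    ∫ ζ : {h : Fin p // h ≠ j} → ℂ, ∫ γ : Fin p → ℂ, marginalIntegrand j s z σ ζ γ

/-- `h_n(z, σ) = (2/n) ∑_j h_n^{(j)}(z, σ)`. -/
noncomputable def meanDensity {p : ℕ} (s : Fin (2 * p) → ℂ) (z : ℂ) (σ : ℝ) : ℝ :=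
  2 / (2 * p : ℕ) * ∑ j : Fin p, marginalDensity j s z σ

/-! ### The quantities `X_j`, `Q_j`, `μ_j`, `D_j`, `f_j`, `β_h` -/

/-- `X_j`, with entries the conjugates of the powers of the nodes. -/
noncomputable def matX {p : ℕ} (j : Fin p) (ζ : {h : Fin p // h ≠ j} → ℂ) (z : ℂ) :
    Matrix (Fin p) (Fin (2 * p)) ℂ :=
  Matrix.of fun h k => (starRingEnd ℂ) (nodes j ζ z h ^ (k : ℕ))

/-- `Q_j = X_j X_jᴴ`. -/
noncomputable def matQ {p : ℕ} (j : Fin p) (ζ : {h : Fin p // h ≠ j} → ℂ) (z : ℂ) :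
    Matrix (Fin p) (Fin p) ℂ :=
  matX j ζ z * (matX j ζ z).conjTranspose

/-- `μ_j = Q_j⁻¹ X_j s`. -/
noncomputable def vecMu {p : ℕ} (j : Fin p) (s : Fin (2 * p) → ℂ)
    (ζ : {h : Fin p // h ≠ j} → ℂ) (z : ℂ) : Fin p → ℂ :=
  (matQ j ζ z)⁻¹.mulVec ((matX j ζ z).mulVec s)

/-- Stacking of real and imaginary parts of a vector. -/
def stackVec {p : ℕ} (v : Fin p → ℂ) : Fin p ⊕ Fin p → ℝ :=
  Sum.elim (fun i => (v i).re) (fun i => (v i).im)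

/-- The real isomorph `[[Re M, -Im M], [Im M, Re M]]` of a complex matrix. -/
def realIsomorph {p : ℕ} (M : Matrix (Fin p) (Fin p) ℂ) :
    Matrix (Fin p ⊕ Fin p) (Fin p ⊕ Fin p) ℝ :=
  Matrix.fromBlocks (M.map Complex.re) (-M.map Complex.im) (M.map Complex.im) (M.map Complex.re)

/-- `D_j`, the determinant of the real isomorph of `Q_j`. -/
noncomputable def detD {p : ℕ} (j : Fin p) (ζ : {h : Fin p // h ≠ j} → ℂ) (z : ℂ) : ℝ :=
  (realIsomorph (matQ j ζ z)).det

/-- `A_i = I₂ ⊗ e_i e_iᵀ`. -/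
def matA {p : ℕ} (i : Fin p) : Matrix (Fin p ⊕ Fin p) (Fin p ⊕ Fin p) ℝ :=
  Matrix.fromBlocks (Matrix.single i i 1) 0 0 (Matrix.single i i 1)

/-- `f_j(ζ^{(j)}, z, σ) = E [∏_i gᵀ A_i g]` where `g` is the real Gaussian vector with mean the
stacked `μ_j` and covariance `(σ²/2) Q̃⁻¹`, `Q̃` being the real isomorph of `Q_j`; its density is
`((π σ²)^{n/2} (det Q̃⁻¹)^{1/2})⁻¹ exp (-σ⁻² (g - μ)ᵀ Q̃ (g - μ))`. -/
noncomputable def quadMoment {p : ℕ} (j : Fin p) (s : Fin (2 * p) → ℂ)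
    (ζ : {h : Fin p // h ≠ j} → ℂ) (z : ℂ) (σ : ℝ) : ℝ :=
  1 / ((Real.pi * σ ^ 2) ^ p * √((realIsomorph (matQ j ζ z))⁻¹.det)) *
    ∫ g : Fin p ⊕ Fin p → ℝ, (∏ i : Fin p, g ⬝ᵥ (matA i).mulVec g) *
      Real.exp (-(1 / σ ^ 2) *
        ((g - stackVec (vecMu j s ζ z)) ⬝ᵥ
          (realIsomorph (matQ j ζ z)).mulVec (g - stackVec (vecMu j s ζ z))))

/-- `b_0, …, b_{n/2}` are the coefficients in the expansion
`f_j(ζ^{(j)}, z, σ) = ∑_h b_h σ^{2h} / (2^h D_j^{n-h})`. They are unique when `D_j ≠ 0`. -/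
def IsMomentExpansion {p : ℕ} (j : Fin p) (s : Fin (2 * p) → ℂ)
    (ζ : {h : Fin p // h ≠ j} → ℂ) (z : ℂ) (b : Fin (p + 1) → ℝ) : Prop :=
  ∀ σ : ℝ, 0 < σ → quadMoment j s ζ z σ =
    ∑ h : Fin (p + 1),
      b h * (σ ^ (2 * (h : ℕ)) / (2 ^ (h : ℕ) * detD j ζ z ^ (2 * p - (h : ℕ))))

open Classical in
/-- `β_h(ζ^{(j)}, z)`: the coefficients of the expansion of `f_j` in powers of `σ²`. -/
noncomputable def coeffBeta {p : ℕ} (j : Fin p) (s : Fin (2 * p) → ℂ)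
    (ζ : {h : Fin p // h ≠ j} → ℂ) (z : ℂ) : Fin (p + 1) → ℝ :=
  if H : ∃ b, IsMomentExpansion j s ζ z b then H.choose else 0

/-- The integrand of the limit density:
`β_{n/2} ∏_{r<h} |ζ_r - ζ_h|⁸ ∏_r |ζ_r - z|⁸ / D_j^{(n+1)/2}`. -/
noncomputable def limitIntegrand {p : ℕ} (j : Fin p) (s : Fin (2 * p) → ℂ) (z : ℂ)
    (ζ : {h : Fin p // h ≠ j} → ℂ) : ℝ :=
  coeffBeta j s ζ z (Fin.last p) *
    ((∏ q : {h : Fin p // h ≠ j} × {h : Fin p // h ≠ j} with q.1 < q.2,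
        ‖ζ q.1 - ζ q.2‖ ^ 8) * ∏ r, ‖ζ r - z‖ ^ 8) /
    detD j ζ z ^ ((((2 * p : ℕ) : ℝ) + 1) / 2)

/-- `(2π)^{-n/2} ∫ β_{n/2} ∏_{r<h} |ζ_r - ζ_h|⁸ ∏_r |ζ_r - z|⁸ / D_j^{(n+1)/2} dζ^{(j)}`. -/
noncomputable def limitDensity {p : ℕ} (j : Fin p) (s : Fin (2 * p) → ℂ) (z : ℂ) : ℝ :=
  1 / (2 * Real.pi) ^ p * ∫ ζ : {h : Fin p // h ≠ j} → ℂ, limitIntegrand j s z ζ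

end

/-! Everything is reduced to one kernel in all nodes `x` and weights `γ`: the squared Jacobian times
`exp(-‖samples x γ - s‖² / σ²)`. The function $h_n^{(j)}$ is its marginal in $x_j$, normalized by
$(\pi\sigma^2)^n$.

The limit is a scaling statement. Substituting $\gamma\mapsto\sigma\gamma$ produces $\sigma^{2p}$
from $|J|^2$ and $\sigma^{2p}$ from $d\gamma$, which cancel the normalization, so $h_n^{(j)}$ for
signal $s$ at level $\sigma$ equals $h_n^{(j)}$ for signal $s/\sigma$ at level $1$
(`marginalDensity_scale`). Dominated convergence then gives the limit $h_n^{(j)}$ at $s=0$,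
$\sigma=1$, and for $s=0$ nothing depends on $\sigma$ at all. Relabelling nodes removes the
dependence on $j$, and a common rotation of the nodes gives circular symmetry.

To identify this limit with the $\beta_{n/2}$ integral, put $g=\mu+\sigma y$ in $f_j$. The moment
becomes an even polynomial in $\sigma$ whose top coefficient $\int\prod|y_i|^2e^{-\|\cdot\|^2}dy$ no
longer sees $\mu$ (`exists_shiftedMoment_eq`). Up to explicit factors this is the inner integral
over $\gamma$ at $s=0$ (`limitIntegrand_eq`).

The condensed density and the convergence of the integrals both come from the map
$(x,\gamma)\mapsto(\sum_h\gamma_hx_h^k)_k$. Its Jacobian is a confluent Vandermonde determinant,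
with squared modulus $|J|^2$; it is injective once nodes are sorted by real part, and it reaches
almost every data vector. On its image the generalized eigenvalues are exactly the nodes, so the
area formula rewrites the expected eigenvalue count as a sum of marginals divided by $p!$, the
number of labellings. Since the total count is $p$ almost surely, the marginal is finite for almost
every $z$; translating the nodes upgrades this to every $z$ (`kernelMass_lt_top`). -/

/-! ### Node vectors with one distinguished coordinate -/

section Insertion

variable {ι : Type*} [DecidableEq ι] [Fintype ι]

/-- Insert the value `z` in position `j`. -/
def insertCoord {ι α : Type*} [DecidableEq ι] (j : ι) (y : ({h : ι // h ≠ j} → α) × α) : ι → α :=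
  fun h => if hj : h = j then y.2 else y.1 ⟨h, hj⟩

theorem measurePreserving_insertCoord (j : ι) :
    MeasurePreserving (insertCoord (α := ℂ) j) := by
  have hm : Measurable (insertCoord (α := ℂ) j) := by
    refine measurable_pi_lambda _ fun h => ?_
    by_cases hj : h = j
    · simp only [insertCoord, hj, dite_true]; fun_prop
    · simp only [insertCoord, hj, dite_false]; fun_prop
  refine ⟨hm, ?_⟩
  refine (Measure.pi_eq fun s hs => ?_).symm
  rw [Measure.map_apply hm (MeasurableSet.univ_pi hs)]
  have : insertCoord (α := ℂ) j ⁻¹' Set.univ.pi s =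
      (Set.univ.pi fun h : {h : ι // h ≠ j} => s h) ×ˢ s j := by
    ext y
    simp only [Set.mem_preimage, Set.mem_pi, Set.mem_univ, forall_true_left, Set.mem_prod]
    constructor
    · intro h
      refine ⟨fun i => ?_, ?_⟩
      · have := h i; simpa [insertCoord, i.2] using this
      · have := h j; simpa [insertCoord] using this
    · rintro ⟨h1, h2⟩ i
      by_cases hj : i = j
      · subst hj; simpa [insertCoord] using h2
      · simpa [insertCoord, hj] using h1 ⟨i, hj⟩
  rw [this, Measure.volume_eq_prod, Measure.prod_prod, volume_pi, Measure.pi_pi, mul_comm]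
  have := Finset.prod_subtype (F := inferInstance) (Finset.univ.erase j) (p := fun h => h ≠ j)
    (by simp) (fun h => (volume : Measure ℂ) (s h))
  rw [← Finset.mul_prod_erase _ _ (Finset.mem_univ j), this]

end Insertion

/-! ### Products of distances between nodes -/

section Spread

variable {ι κ : Type*} [DecidableEq ι] [Fintype ι] [DecidableEq κ] [Fintype κ]

/-- The product of the distances `‖x i - x h‖` over all ordered pairs `i ≠ h`. -/
noncomputable def spread {ι : Type*} [DecidableEq ι] [Fintype ι] (x : ι → ℂ) : ℝ :=
  ∏ i, ∏ h ∈ Finset.univ.erase i, ‖x i - x h‖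

theorem spread_nonneg (x : ι → ℂ) : 0 ≤ spread x :=
  Finset.prod_nonneg fun _ _ => Finset.prod_nonneg fun _ _ => norm_nonneg _

theorem spread_eq_ite (x : ι → ℂ) :
    spread x = ∏ i, ∏ h, if i = h then 1 else ‖x i - x h‖ := by
  refine Finset.prod_congr rfl fun i _ => ?_
  rw [← Finset.mul_prod_erase Finset.univ _ (Finset.mem_univ i), if_pos rfl, one_mul]
  exact Finset.prod_congr rfl fun h hh => by rw [if_neg (Finset.ne_of_mem_erase hh).symm]

theorem spread_comp_equiv (x : ι → ℂ) (e : κ ≃ ι) : spread (x ∘ e) = spread x := by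
  rw [spread_eq_ite, spread_eq_ite, ← e.prod_comp]
  refine Finset.prod_congr rfl fun i _ => ?_
  rw [← e.prod_comp]
  simp

theorem spread_eq_zero_iff (x : ι → ℂ) : spread x = 0 ↔ ¬ Function.Injective x := by
  simp only [spread, Finset.prod_eq_zero_iff, Finset.mem_univ, true_and, Finset.mem_erase,
    norm_eq_zero, sub_eq_zero, Function.Injective, not_forall]
  constructor
  · rintro ⟨i, h, hne, he⟩
    exact ⟨i, h, he, fun e => hne.1 e.symm⟩
  · rintro ⟨i, h, he, hne⟩
    exact ⟨i, h, ⟨fun e => hne e.symm, trivial⟩, he⟩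

theorem spread_smul (u : ℂ) (hu : ‖u‖ = 1) (x : ι → ℂ) : spread (fun i => u * x i) = spread x := by
  simp [spread, ← mul_sub, hu]

theorem spread_add_const (a : ℂ) (x : ι → ℂ) : spread (fun i => x i + a) = spread x := by
  simp [spread]

theorem continuous_spread : Continuous (spread : (ι → ℂ) → ℝ) := by
  unfold spread; fun_prop

theorem spread_sumElim (x : ι → ℂ) (y : κ → ℂ) :
    spread (Sum.elim x y) = spread x * spread y * (∏ i, ∏ h, ‖x i - y h‖) ^ 2 := by
  simp only [spread_eq_ite, Fintype.prod_sum_type, Sum.elim_inl, Sum.elim_inr, Sum.inl.injEq,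
    Sum.inr.injEq, reduceCtorEq, if_false, Finset.prod_mul_distrib]
  have : ∏ i, ∏ h, ‖y i - x h‖ = ∏ i, ∏ h, ‖x i - y h‖ := by
    rw [Finset.prod_comm]
    simp_rw [norm_sub_rev]
  rw [this]
  ring

/-- The pairs `i < h` and `h < i` contribute equally. The product over ordered pairs is preferred
later because it is visibly invariant under relabelling. -/
theorem prod_lt_sq_eq_spread [LinearOrder ι] (x : ι → ℂ) :
    (∏ q : ι × ι with q.1 < q.2, ‖x q.1 - x q.2‖) ^ 2 = spread x := by
  have h1 : spread x = ∏ q : ι × ι, if q.1 = q.2 then 1 else ‖x q.1 - x q.2‖ := by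
    rw [spread_eq_ite, Fintype.prod_prod_type]
  have h2 : ∀ q : ι × ι, (if q.1 = q.2 then 1 else ‖x q.1 - x q.2‖) =
      (if q.1 < q.2 then ‖x q.1 - x q.2‖ else 1) * (if q.2 < q.1 then ‖x q.1 - x q.2‖ else 1) := by
    intro q
    rcases lt_trichotomy q.1 q.2 with h | h | h
    · simp [h, h.ne, h.le.not_gt]
    · simp [h]
    · simp [h, h.ne', h.le.not_gt]
  simp_rw [h1, h2]
  rw [Finset.prod_mul_distrib, sq, Finset.prod_filter]
  congr 1
  rw [← (Equiv.prodComm ι ι).prod_comp]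
  refine Finset.prod_congr rfl fun q _ => ?_
  simp [norm_sub_rev]

theorem spread_insertCoord (j : ι) (ζ : {h : ι // h ≠ j} → ℂ) (z : ℂ) :
    spread (insertCoord j (ζ, z)) = spread ζ * (∏ r, ‖ζ r - z‖) ^ 2 := by
  let e : {h : ι // h ≠ j} ⊕ Unit ≃ ι :=
    { toFun := Sum.elim Subtype.val fun _ => j
      invFun := fun h => if hj : h = j then Sum.inr () else Sum.inl ⟨h, hj⟩
      left_inv := by
        rintro (h | h)
        · simp [h.2]
        · simp
      right_inv := by
        intro h
        by_cases hj : h = j <;> simp [hj] }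
  have : insertCoord j (ζ, z) ∘ e = Sum.elim ζ fun _ => z := by
    funext h
    rcases h with h | h
    · simp [e, insertCoord, h.2]
    · simp [e, insertCoord]
  rw [← spread_comp_equiv _ e, this, spread_sumElim]
  simp [spread]

end Spread

/-! ### The joint kernel in all nodes and weights -/

/-- The samples `∑_h γ_h x_h ^ k` of a complex exponentials model. -/
noncomputable def samples {p : ℕ} (x γ : Fin p → ℂ) : Fin (2 * p) → ℂ :=
  fun k => ∑ h, γ h * x h ^ (k : ℕ)

/-- The modulus of the Jacobian determinant of `(x, γ) ↦ samples x γ`. -/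
noncomputable def jacNorm {p : ℕ} (x γ : Fin p → ℂ) : ℝ :=
  (∏ i, ‖γ i‖) * spread x ^ 2

/-- The integrand of `h_n^{(j)}` as a function of all the nodes. -/
noncomputable def jointKernel {p : ℕ} (s : Fin (2 * p) → ℂ) (σ : ℝ) (x γ : Fin p → ℂ) : ℝ :=
  jacNorm x γ ^ 2 * Real.exp (-(1 / σ ^ 2) * ∑ k, ‖samples x γ k - s k‖ ^ 2)

theorem prod_norm_eq_spread {p : ℕ} (j : Fin p) (ζ : {h : Fin p // h ≠ j} → ℂ) (z : ℂ) :
    (∏ q : {h : Fin p // h ≠ j} × {h : Fin p // h ≠ j} with q.1 < q.2, ‖ζ q.1 - ζ q.2‖ ^ 4) *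
      ∏ r, ‖ζ r - z‖ ^ 4 = spread (nodes j ζ z) ^ 2 := by
  have : nodes j ζ z = insertCoord j (ζ, z) := rfl
  rw [this, spread_insertCoord, ← prod_lt_sq_eq_spread, Finset.prod_pow, Finset.prod_pow]
  ring

theorem norm_jacobianC {p : ℕ} (j : Fin p) (ζ : {h : Fin p // h ≠ j} → ℂ) (z : ℂ)
    (γ : Fin p → ℂ) : ‖jacobianC j ζ z γ‖ = jacNorm (nodes j ζ z) γ := by
  rw [jacNorm, ← prod_norm_eq_spread]
  simp only [jacobianC, norm_mul, norm_prod, norm_pow, norm_neg, norm_one, one_pow, one_mul]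
  ring

theorem marginalIntegrand_eq {p : ℕ} (j : Fin p) (s : Fin (2 * p) → ℂ) (z : ℂ) (σ : ℝ)
    (ζ : {h : Fin p // h ≠ j} → ℂ) (γ : Fin p → ℂ) :
    marginalIntegrand j s z σ ζ γ = jointKernel s σ (nodes j ζ z) γ := by
  rw [marginalIntegrand, norm_jacobianC]; rfl

theorem jointKernel_nonneg {p : ℕ} (s : Fin (2 * p) → ℂ) (σ : ℝ) (x γ : Fin p → ℂ) :
    0 ≤ jointKernel s σ x γ := by
  unfold jointKernel; positivity

theorem continuous_jointKernel {p : ℕ} (s : Fin (2 * p) → ℂ) (σ : ℝ) :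
    Continuous fun y : (Fin p → ℂ) × (Fin p → ℂ) => jointKernel s σ y.1 y.2 := by
  have := continuous_spread (ι := Fin p)
  unfold jointKernel jacNorm samples
  fun_prop

theorem continuous_nodes {p : ℕ} (j : Fin p) :
    Continuous fun y : ({h : Fin p // h ≠ j} → ℂ) × ℂ => nodes j y.1 y.2 := by
  refine continuous_pi fun h => ?_
  by_cases hj : h = j
  · simp only [nodes, hj, dite_true]; fun_prop
  · simp only [nodes, hj, dite_false]; fun_prop

theorem measurePreserving_nodes {p : ℕ} (j : Fin p) :
    MeasurePreserving fun y : ({h : Fin p // h ≠ j} → ℂ) × ℂ => nodes j y.1 y.2 :=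
  measurePreserving_insertCoord j

theorem samples_comp_equiv {p : ℕ} (x γ : Fin p → ℂ) (e : Equiv.Perm (Fin p)) :
    samples (x ∘ e) (γ ∘ e) = samples x γ := by
  funext k
  exact Equiv.sum_comp e fun h => γ h * x h ^ (k : ℕ)

theorem jacNorm_comp_equiv {p : ℕ} (x γ : Fin p → ℂ) (e : Equiv.Perm (Fin p)) :
    jacNorm (x ∘ e) (γ ∘ e) = jacNorm x γ := by
  rw [jacNorm, jacNorm, spread_comp_equiv]
  congr 1
  exact Equiv.prod_comp e fun i => ‖γ i‖

theorem jointKernel_comp_equiv {p : ℕ} (s : Fin (2 * p) → ℂ) (σ : ℝ) (x γ : Fin p → ℂ)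
    (e : Equiv.Perm (Fin p)) : jointKernel s σ (x ∘ e) (γ ∘ e) = jointKernel s σ x γ := by
  rw [jointKernel, jointKernel, jacNorm_comp_equiv, samples_comp_equiv]

/-- The identification of two blocks of `p` indices with the `2 * p` sample indices. -/
def sampleEquiv (p : ℕ) : Fin p ⊕ Fin p ≃ Fin (2 * p) :=
  finSumFinEquiv.trans (finCongr (two_mul p).symm)

theorem norm_det_vandermonde_sq {n : ℕ} (w : Fin n → ℂ) :
    ‖(Matrix.vandermonde w).det‖ ^ 2 = spread w := by
  rw [← prod_lt_sq_eq_spread, Matrix.det_vandermonde, Finset.prod_filter,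
    Fintype.prod_prod_type, norm_prod]
  congr 1
  refine Finset.prod_congr rfl fun i _ => ?_
  rw [norm_prod, ← Finset.prod_filter]
  refine Finset.prod_congr (by ext; simp) fun h _ => norm_sub_rev _ _

/-! ### The confluent Vandermonde determinant -/

section Confluent

variable {p : ℕ} (x : Fin p → ℂ)

/-- Vandermonde matrix with nodes `x_h + t` and `x_h`. -/
def doubledVandermonde (t : ℂ) : Matrix (Fin p ⊕ Fin p) (Fin p ⊕ Fin p) ℂ :=
  Matrix.of fun h k => Sum.elim (fun h => x h + t) x h ^ (sampleEquiv p k : ℕ)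

/-- Rows of divided differences of the powers between `x_h + t` and `x_h`, and rows of powers
of `x_h`; for `t = 0` this is the confluent Vandermonde matrix. -/
def dividedVandermonde (t : ℂ) : Matrix (Fin p ⊕ Fin p) (Fin p ⊕ Fin p) ℂ :=
  Matrix.of (Sum.elim
    (fun h k => ∑ a ∈ Finset.range (sampleEquiv p k),
      (x h + t) ^ a * x h ^ ((sampleEquiv p k : ℕ) - 1 - a))
    (fun h k => x h ^ (sampleEquiv p k : ℕ)))

/-- Subtracting row `x_h` from row `x_h + t` and dividing by `t` gives divided differences; the
factorization isolates the power of `t` that makes the determinant degenerate at `t = 0`. -/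
theorem doubledVandermonde_eq (t : ℂ) :
    doubledVandermonde x t =
      Matrix.fromBlocks (t • (1 : Matrix (Fin p) (Fin p) ℂ)) 1 0 1 * dividedVandermonde x t := by
  ext h k
  rw [Matrix.mul_apply]
  rcases h with h | h
  · simp only [doubledVandermonde, dividedVandermonde, Matrix.of_apply, Sum.elim_inl,
      Fintype.sum_sum_type, Matrix.fromBlocks_apply₁₁, Matrix.fromBlocks_apply₁₂, Matrix.smul_apply,
      Matrix.one_apply, Sum.elim_inr, smul_eq_mul, mul_ite, mul_one, mul_zero, ite_mul, zero_mul,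
      one_mul, Finset.sum_ite_eq, Finset.mem_univ, if_true]
    have := (Commute.all (x h + t) (x h)).mul_geom_sum₂ (sampleEquiv p k : ℕ)
    rw [add_sub_cancel_left] at this
    rw [this]; ring
  · simp only [doubledVandermonde, dividedVandermonde, Matrix.of_apply, Sum.elim_inl,
      Fintype.sum_sum_type, Matrix.fromBlocks_apply₂₁, Matrix.fromBlocks_apply₂₂, Matrix.zero_apply,
      Matrix.one_apply, Sum.elim_inr, ite_mul, zero_mul,
      one_mul, Finset.sum_ite_eq, Finset.mem_univ, if_true, Finset.sum_const_zero, zero_add]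

theorem norm_det_doubledVandermonde_sq (t : ℂ) :
    ‖(doubledVandermonde x t).det‖ ^ 2 =
      spread x ^ 2 * (‖t‖ ^ p * ∏ i, ∏ h ∈ Finset.univ.erase i, ‖x i - x h + t‖) ^ 2 := by
  have h1 : doubledVandermonde x t =
      (Matrix.vandermonde (Sum.elim (fun h => x h + t) x ∘ (sampleEquiv p).symm)).submatrix
        (sampleEquiv p) (sampleEquiv p) := by
    ext h k; simp [doubledVandermonde, Matrix.vandermonde]
  rw [h1, Matrix.det_submatrix_equiv_self, norm_det_vandermonde_sq, spread_comp_equiv,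
    spread_sumElim, spread_add_const]
  have h2 : ∏ i, ∏ h, ‖x i + t - x h‖ =
      ‖t‖ ^ p * ∏ i, ∏ h ∈ Finset.univ.erase i, ‖x i - x h + t‖ := by
    have : ∀ i, ∏ h, ‖x i + t - x h‖ = ‖t‖ * ∏ h ∈ Finset.univ.erase i, ‖x i - x h + t‖ := by
      intro i
      rw [← Finset.mul_prod_erase _ _ (Finset.mem_univ i), add_sub_cancel_left]
      congr 1
      exact Finset.prod_congr rfl fun h _ => by congr 1; ring
    simp_rw [this]
    rw [Finset.prod_mul_distrib]
    simp
  rw [h2]; ring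

/-- The confluent determinant is the limit of an ordinary Vandermonde determinant whose nodes merge
in pairs: the factor `‖t‖ ^ p` cancels, and each remaining distance occurs four times. -/
theorem norm_det_dividedVandermonde_zero :
    ‖(dividedVandermonde x 0).det‖ = spread x ^ 2 := by
  have h1 : (fun t => ‖(dividedVandermonde x t).det‖ ^ 2) =
      fun t => spread x ^ 2 * (∏ i, ∏ h ∈ Finset.univ.erase i, ‖x i - x h + t‖) ^ 2 := by
    -- Cancelling the power of `‖t‖` needs `t ≠ 0`; the value at `0` follows by continuity.
    refine Continuous.ext_on (dense_compl_singleton (0 : ℂ)) ?_ ?_ ?_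
    · have : Continuous fun t => dividedVandermonde x t := by
        refine continuous_matrix fun h k => ?_
        rcases h with h | h
        · simp only [dividedVandermonde, Matrix.of_apply, Sum.elim_inl]; fun_prop
        · simp only [dividedVandermonde, Matrix.of_apply, Sum.elim_inr]; fun_prop
      exact (this.matrix_det.norm).pow 2
    · fun_prop
    · intro t ht
      have ht' : ‖t‖ ≠ 0 := norm_ne_zero_iff.2 ht
      have h := norm_det_doubledVandermonde_sq x t
      rw [doubledVandermonde_eq, Matrix.det_mul, Matrix.det_fromBlocks_zero₂₁, Matrix.det_one,
        mul_one, Matrix.det_smul, Matrix.det_one, mul_one, Fintype.card_fin, norm_mul, norm_pow,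
        mul_pow] at h
      have h3 : (‖t‖ ^ p) ^ 2 ≠ 0 := by positivity
      refine mul_left_cancel₀ h3 ?_
      dsimp only
      rw [h]; ring
  have h2 := congrFun h1 0
  simp only [add_zero] at h2
  have h3 : (∏ i, ∏ h ∈ Finset.univ.erase i, ‖x i - x h‖) = spread x := rfl
  rw [h3] at h2
  have h4 := spread_nonneg x
  refine (sq_eq_sq₀ (norm_nonneg _) (by positivity)).1 ?_
  rw [h2]; ring

end Confluent

/-! ### Jacobian of the moment map -/

section MomentMap

variable {p : ℕ}

/-- The map `(x, γ) ↦ samples x γ`, with source and target indexed by the same type. -/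
noncomputable def momentMap (v : Fin p ⊕ Fin p → ℂ) : Fin p ⊕ Fin p → ℂ :=
  fun i => samples (v ∘ Sum.inl) (v ∘ Sum.inr) (sampleEquiv p i)

/-- The complex Jacobian matrix of `momentMap`. -/
noncomputable def momentJacobian (v : Fin p ⊕ Fin p → ℂ) :
    Matrix (Fin p ⊕ Fin p) (Fin p ⊕ Fin p) ℂ :=
  (dividedVandermonde (v ∘ Sum.inl) 0).transpose *
    Matrix.diagonal (Sum.elim (v ∘ Sum.inr) 1)

theorem norm_det_momentJacobian (v : Fin p ⊕ Fin p → ℂ) :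
    ‖(momentJacobian v).det‖ = jacNorm (v ∘ Sum.inl) (v ∘ Sum.inr) := by
  rw [momentJacobian, Matrix.det_mul, Matrix.det_transpose, norm_mul,
    norm_det_dividedVandermonde_zero, Matrix.det_diagonal, jacNorm, Fintype.prod_sum_type]
  simp [mul_comm]

theorem hasFDerivAt_momentMap_complex (v : Fin p ⊕ Fin p → ℂ) :
    HasFDerivAt momentMap (Matrix.toLin' (momentJacobian v)).toContinuousLinearMap v := by
  rw [hasFDerivAt_pi']
  intro i
  have hp : ∀ q : Fin p ⊕ Fin p, HasFDerivAt (fun w : Fin p ⊕ Fin p → ℂ => w q)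
      (ContinuousLinearMap.proj (R := ℂ) (φ := fun _ : Fin p ⊕ Fin p => ℂ) q) v :=
    fun q => hasFDerivAt_apply q v
  have h := HasFDerivAt.fun_sum (u := Finset.univ) fun (h : Fin p) _ =>
    (hp (Sum.inr h)).mul ((hp (Sum.inl h)).pow (sampleEquiv p i : ℕ))
  refine HasFDerivAt.congr_fderiv (f := fun w => momentMap w i) h ?_
  ext w
  simp only [momentJacobian, dividedVandermonde, add_zero, ← pow_add]
  simp only [sum_apply, add_apply,
    smul_apply, ContinuousLinearMap.proj_apply, smul_eq_mul,
    ContinuousLinearMap.comp_apply, LinearMap.coe_toContinuousLinearMap', Matrix.toLin'_apply,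
    Matrix.mulVec, dotProduct, Fintype.sum_sum_type, Matrix.mul_diagonal, Matrix.transpose_apply,
    Matrix.of_apply, Sum.elim_inl, Sum.elim_inr, Function.comp_apply, Pi.one_apply, mul_one]
  rw [← Finset.sum_add_distrib]
  refine Finset.sum_congr rfl fun h _ => ?_
  -- At `t = 0` the divided difference is the derivative `k x^(k-1)`. Truncated subtraction does no
  -- harm: for `k = 0` the sum is empty and the right side has the factor `0`.
  have : ∑ a ∈ Finset.range (sampleEquiv p i : ℕ),
      v (Sum.inl h) ^ (a + ((sampleEquiv p i : ℕ) - 1 - a)) =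
      (sampleEquiv p i : ℕ) * v (Sum.inl h) ^ ((sampleEquiv p i : ℕ) - 1) := by
    rw [Finset.sum_congr rfl (g := fun _ => v (Sum.inl h) ^ ((sampleEquiv p i : ℕ) - 1))]
    · simp
    · intro a ha
      rw [Finset.mem_range] at ha
      congr 1; omega
  rw [this]
  simp only [nsmul_eq_mul]
  ring

theorem hasFDerivAt_momentMap (v : Fin p ⊕ Fin p → ℂ) :
    HasFDerivAt momentMap
      ((Matrix.toLin' (momentJacobian v)).toContinuousLinearMap.restrictScalars ℝ) v :=
  (hasFDerivAt_momentMap_complex v).restrictScalars ℝ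

/-- The real determinant of a complex linear map is the squared modulus of its complex determinant,
which is why the Jacobian enters the kernel squared. -/
theorem abs_det_fderiv_momentMap (v : Fin p ⊕ Fin p → ℂ) :
    |((Matrix.toLin' (momentJacobian v)).toContinuousLinearMap.restrictScalars ℝ).det| =
      jacNorm (v ∘ Sum.inl) (v ∘ Sum.inr) ^ 2 := by
  have : ((Matrix.toLin' (momentJacobian v)).toContinuousLinearMap.restrictScalars ℝ).det =
      LinearMap.det ((Matrix.toLin' (momentJacobian v)).restrictScalars ℝ) := rfl
  rw [this, LinearMap.det_restrictScalars, LinearMap.det_toLin', Algebra.norm_complex_apply,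
    Complex.normSq_eq_norm_sq, norm_det_momentJacobian]
  exact abs_of_nonneg (by positivity)

end MomentMap

/-! ### Factorization of the Hankel pencil -/

section Pencil

variable {p : ℕ} (x γ : Fin p → ℂ)

theorem hankelZero_samples :
    hankelZero (samples x γ) =
      (Matrix.vandermonde x).transpose * Matrix.diagonal γ * Matrix.vandermonde x := by
  ext a b
  rw [Matrix.mul_apply]
  simp only [hankelZero, samples, Matrix.of_apply, Matrix.mul_diagonal, Matrix.transpose_apply,
    Matrix.vandermonde_apply, pow_add]
  exact Finset.sum_congr rfl fun h _ => by ring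

theorem det_hankelZero_samples :
    (hankelZero (samples x γ)).det = (Matrix.vandermonde x).det ^ 2 * ∏ h, γ h := by
  rw [hankelZero_samples, Matrix.det_mul, Matrix.det_mul, Matrix.det_transpose,
    Matrix.det_diagonal]
  ring

/-- With `V` the Vandermonde matrix of the nodes, `U₀ = Vᵀ diag(γ) V` and `U₁ = Vᵀ diag(γ x) V`, so
the pencil is diagonalized by congruence. -/
theorem det_pencil_samples :
    ((hankelOne (samples x γ)).map Polynomial.C -
      (Polynomial.X : Polynomial ℂ) • (hankelZero (samples x γ)).map Polynomial.C).det =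
      Polynomial.C ((-1) ^ p * (Matrix.vandermonde x).det ^ 2 * ∏ h, γ h) *
        ∏ h, (Polynomial.X - Polynomial.C (x h)) := by
  have h1 : (hankelOne (samples x γ)).map Polynomial.C -
      (Polynomial.X : Polynomial ℂ) • (hankelZero (samples x γ)).map Polynomial.C =
      ((Matrix.vandermonde x).map Polynomial.C).transpose *
        Matrix.diagonal (fun h => Polynomial.C (γ h) * -(Polynomial.X - Polynomial.C (x h))) *
        (Matrix.vandermonde x).map Polynomial.C := by
    ext1 a b
    rw [Matrix.mul_apply]
    simp only [hankelOne, hankelZero, samples, Matrix.of_apply, Matrix.mul_diagonal,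
      Matrix.transpose_apply, Matrix.vandermonde_apply, Matrix.sub_apply, Matrix.map_apply,
      Matrix.smul_apply, smul_eq_mul, map_sum, Finset.mul_sum, map_mul, map_pow]
    rw [← Finset.sum_sub_distrib]
    exact Finset.sum_congr rfl fun h _ => by ring
  have h2 : ((Matrix.vandermonde x).map Polynomial.C).det =
      Polynomial.C (Matrix.vandermonde x).det := (RingHom.map_det Polynomial.C _).symm
  rw [h1, Matrix.det_mul, Matrix.det_mul, Matrix.det_transpose, Matrix.det_diagonal, h2,
    Finset.prod_mul_distrib, Finset.prod_neg]
  simp only [Finset.card_univ, Fintype.card_fin, map_mul, map_pow, map_prod, map_neg, map_one]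
  ring

theorem generalizedEigenvalues_samples (hx : Function.Injective x) (hγ : ∀ h, γ h ≠ 0) :
    generalizedEigenvalues (hankelOne (samples x γ)) (hankelZero (samples x γ)) =
      Finset.univ.val.map x := by
  rw [generalizedEigenvalues, det_pencil_samples, Polynomial.roots_C_mul]
  · exact Polynomial.roots_multiset_prod_X_sub_C (Finset.univ.val.map x) ▸ by
      rw [Multiset.map_map]; rfl
  · have : (Matrix.vandermonde x).det ≠ 0 := Matrix.det_vandermonde_ne_zero_iff.2 hx
    have : ∏ h, γ h ≠ 0 := Finset.prod_ne_zero_iff.2 fun h _ => hγ h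
    simp_all

end Pencil

/-! ### Injectivity of the moment map on sorted parameters -/

/-- Nonzero weights and nodes sorted by their real parts: a fundamental domain for the
permutations of the components of the model. -/
def sortedParams (p : ℕ) : Set (Fin p ⊕ Fin p → ℂ) :=
  {v | StrictMono (fun h => (v (Sum.inl h)).re) ∧ ∀ h, v (Sum.inr h) ≠ 0}

theorem injective_of_re_injective {ι : Type*} {x : ι → ℂ}
    (h : Function.Injective fun i => (x i).re) : Function.Injective x :=
  fun _ _ e => h (congrArg Complex.re e)

theorem samples_right_injective {p : ℕ} {x : Fin p → ℂ} (hx : Function.Injective x) :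
    Function.Injective (samples x) := by
  intro γ γ' h
  rw [← sub_eq_zero]
  refine Matrix.eq_zero_of_forall_pow_sum_mul_pow_eq_zero hx fun i => ?_
  have := congrFun h ⟨i, by omega⟩
  simp only [samples] at this
  simp [sub_mul, this]

/-- The data determine the nodes as a multiset, namely the generalized eigenvalues; sorting fixes
their labels, and the weights then solve a Vandermonde system. -/
theorem injOn_momentMap (p : ℕ) : Set.InjOn momentMap (sortedParams p) := by
  intro v hv w hw h
  have hs : samples (v ∘ Sum.inl) (v ∘ Sum.inr) = samples (w ∘ Sum.inl) (w ∘ Sum.inr) := by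
    funext k
    have := congrFun h ((sampleEquiv p).symm k)
    simpa [momentMap] using this
  have hvi : Function.Injective (v ∘ Sum.inl) := injective_of_re_injective hv.1.injective
  have hwi : Function.Injective (w ∘ Sum.inl) := injective_of_re_injective hw.1.injective
  have e1 := generalizedEigenvalues_samples (v ∘ Sum.inl) (v ∘ Sum.inr) hvi hv.2
  rw [hs, generalizedEigenvalues_samples (w ∘ Sum.inl) (w ∘ Sum.inr) hwi hw.2] at e1
  have hmem : ∀ i, ∃ k, v (Sum.inl k) = w (Sum.inl i) := by
    intro i
    have : w (Sum.inl i) ∈ Finset.univ.val.map (w ∘ Sum.inl) :=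
      Multiset.mem_map_of_mem _ (Finset.mem_univ_val i)
    rw [e1, Multiset.mem_map] at this
    obtain ⟨k, -, hk⟩ := this
    exact ⟨k, hk⟩
  have hmem' : ∀ i, ∃ k, w (Sum.inl k) = v (Sum.inl i) := by
    intro i
    have : v (Sum.inl i) ∈ Finset.univ.val.map (v ∘ Sum.inl) :=
      Multiset.mem_map_of_mem _ (Finset.mem_univ_val i)
    rw [← e1, Multiset.mem_map] at this
    obtain ⟨k, -, hk⟩ := this
    exact ⟨k, hk⟩
  have hre := (hv.1.range_inj hw.1).1 (by
    ext r
    constructor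
    · rintro ⟨i, rfl⟩
      obtain ⟨k, hk⟩ := hmem' i
      exact ⟨k, congrArg Complex.re hk⟩
    · rintro ⟨i, rfl⟩
      obtain ⟨k, hk⟩ := hmem i
      exact ⟨k, congrArg Complex.re hk⟩)
  have hx : v ∘ Sum.inl = w ∘ Sum.inl := by
    funext i
    obtain ⟨k, hk⟩ := hmem i
    have : k = i := hv.1.injective
      (by simpa [hk] using (congrFun hre i).symm)
    subst this
    exact hk
  have hy : v ∘ Sum.inr = w ∘ Sum.inr := by
    rw [hx] at hs
    exact samples_right_injective hwi hs
  funext i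
  rcases i with i | i
  · exact congrFun hx i
  · exact congrFun hy i

/-! ### Data vectors as solutions of linear recurrences -/

section Recurrence

theorem LinearRecurrence.mkSol_eq (E : LinearRecurrence ℂ) (u : Fin E.order → ℂ) (k : ℕ) :
    E.mkSol u k = if h : k < E.order then u ⟨k, h⟩ else
      ∑ a, E.coeffs a * E.mkSol u (k - E.order + a) := by
  rw [mkSol]

variable {p : ℕ}

/-- The recurrence whose characteristic polynomial has roots `x`. -/
noncomputable def rootRecurrence (x : Fin p → ℂ) : LinearRecurrence ℂ where
  order := p
  coeffs a := -(∏ h, (Polynomial.X - Polynomial.C (x h))).coeff a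

theorem geom_isSolution_rootRecurrence (x : Fin p → ℂ) (h : Fin p) :
    (rootRecurrence x).IsSolution fun n => x h ^ n := by
  intro n
  have hm : (∏ h, (Polynomial.X - Polynomial.C (x h))).Monic :=
    Polynomial.monic_prod_X_sub_C _ _
  have hd : (∏ h, (Polynomial.X - Polynomial.C (x h))).natDegree = p := by
    rw [Polynomial.natDegree_finsetProd_X_sub_C_eq_card]; simp
  have h0 : (∏ h, (Polynomial.X - Polynomial.C (x h))).eval (x h) = 0 := by
    rw [Polynomial.eval_prod]
    exact Finset.prod_eq_zero (Finset.mem_univ h) (by simp)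
  rw [Polynomial.eval_eq_sum_range, hd, Finset.sum_range_succ] at h0
  have hc := hm.coeff_natDegree
  rw [hd] at hc
  have hr := Fin.sum_univ_eq_sum_range
    (fun i : ℕ => (∏ h, (Polynomial.X - Polynomial.C (x h))).coeff i * x h ^ i) p
  rw [hc, one_mul, ← hr] at h0
  simp only [rootRecurrence]
  rw [pow_add, eq_neg_of_add_eq_zero_right h0, mul_neg, Finset.mul_sum, ← Finset.sum_neg_distrib]
  exact Finset.sum_congr rfl fun a _ => by ring

/-- Used to show that the solution of the recurrence depends differentiably on roots and initial
values, hence that null sets of parameters yield null sets of data. -/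
theorem differentiable_coeff_prod {E ι : Type*} [NormedAddCommGroup E] [NormedSpace ℂ E]
    (s : Finset ι) (f : ι → E → ℂ) (hf : ∀ i, Differentiable ℂ (f i)) (k : ℕ) :
    Differentiable ℂ fun v => (∏ h ∈ s, (Polynomial.X - Polynomial.C (f h v))).coeff k := by
  classical
  induction s using Finset.induction_on generalizing k with
  | empty => simp
  | insert a s ha ih =>
    simp only [Finset.prod_insert ha, Polynomial.coeff_mul, Polynomial.coeff_sub]
    refine Differentiable.fun_sum fun q _ => ?_
    refine Differentiable.mul ?_ (ih _)
    simp only [Polynomial.coeff_C]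
    split_ifs
    · exact (hf a).const_sub _
    · simp

/-- The sequence with initial values `u` that satisfies the recurrence with characteristic
roots `x`. -/
noncomputable def recurSol (x u : Fin p → ℂ) (k : ℕ) : ℂ := (rootRecurrence x).mkSol u k

theorem recurSol_eq (x u : Fin p → ℂ) (k : ℕ) :
    recurSol x u k = if h : k < p then u ⟨k, h⟩ else
      ∑ a : Fin p, -(∏ h, (Polynomial.X - Polynomial.C (x h))).coeff a *
        recurSol x u (k - p + a) :=
  LinearRecurrence.mkSol_eq (rootRecurrence x) u k

theorem recurSol_comp_perm (x u : Fin p → ℂ) (e : Equiv.Perm (Fin p)) :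
    recurSol (x ∘ e) u = recurSol x u := by
  have : rootRecurrence (x ∘ e) = rootRecurrence x := by
    have h : ∏ h, (Polynomial.X - Polynomial.C ((x ∘ e) h)) =
        ∏ h, (Polynomial.X - Polynomial.C (x h)) :=
      Equiv.prod_comp e fun h => Polynomial.X - Polynomial.C (x h)
    simp only [rootRecurrence, h]
  funext k
  unfold recurSol
  congr

theorem samples_eq_recurSol (x γ u : Fin p → ℂ)
    (hu : ∀ k : Fin p, ∑ h, γ h * x h ^ (k : ℕ) = u k) (k : Fin (2 * p)) :
    samples x γ k = recurSol x u k := by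
  refine (rootRecurrence x).eq_mk_of_is_sol_of_eq_init (u := fun n => ∑ h, γ h * x h ^ n) ?_ hu k
  rw [LinearRecurrence.is_sol_iff_mem_solSpace]
  have : (fun n => ∑ h, γ h * x h ^ n) = ∑ h, γ h • fun n => x h ^ n := by
    funext n; simp
  rw [this]
  exact Submodule.sum_mem _ fun h _ => Submodule.smul_mem _ _
    (geom_isSolution_rootRecurrence x h)

theorem differentiable_recurSol (k : ℕ) :
    Differentiable ℂ fun v : Fin p ⊕ Fin p → ℂ => recurSol (v ∘ Sum.inl) (v ∘ Sum.inr) k := by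
  induction k using Nat.strong_induction_on with
  | _ k ih =>
    simp_rw [recurSol_eq _ _ k]
    split_ifs with h
    · simp only [Function.comp_apply]; fun_prop
    · refine Differentiable.fun_sum fun a _ => ?_
      have := differentiable_coeff_prod Finset.univ
        (fun (h : Fin p) (v : Fin p ⊕ Fin p → ℂ) => v (Sum.inl h)) (fun h => by fun_prop) a
      exact this.neg.mul (ih _ (by omega))

/-- Prony's method: the recurrence coefficients solve the system with matrix `U₀`, and the nodes are
the roots of the characteristic polynomial. Roots may coincide here, where a representation by
`samples` could fail; hence the recurrence form. -/
theorem exists_eq_recurSol (d : Fin (2 * p) → ℂ) (hd : (hankelZero d).det ≠ 0) :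
    ∃ x : Fin p → ℂ, ∀ k : Fin (2 * p),
      d k = recurSol x (fun a => d ⟨a, by omega⟩) k := by
  obtain ⟨c, hc⟩ : ∃ c, (hankelZero d).mulVec c = fun b : Fin p => d ⟨p + b, by omega⟩ :=
    ⟨(hankelZero d)⁻¹.mulVec fun b : Fin p => d ⟨p + b, by omega⟩, by
      rw [Matrix.mulVec_mulVec, Matrix.mul_nonsing_inv _ hd.isUnit, Matrix.one_mulVec]⟩
  set Q : Polynomial ℂ := Polynomial.X ^ p - ∑ a : Fin p, Polynomial.C (c a) * Polynomial.X ^ (a : ℕ)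
    with hQ
  have hdeg : (∑ a : Fin p, Polynomial.C (c a) * Polynomial.X ^ (a : ℕ)).degree < (p : WithBot ℕ) :=
    Polynomial.degree_sum_fin_lt _
  have hmonic : Q.Monic := Polynomial.monic_X_pow_sub hdeg
  have hnat : Q.natDegree = p := by
    rw [Polynomial.natDegree_eq_of_degree_eq_some]
    rw [hQ, Polynomial.degree_sub_eq_left_of_degree_lt] <;> simp [hdeg]
  have hcoeff : ∀ a : Fin p, Q.coeff a = -c a := by
    intro a
    simp [hQ, Polynomial.coeff_X_pow, Fin.val_inj, (a.2).ne]
  have hsplit := IsAlgClosed.splits Q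
  have hcard : Q.roots.card = p := by rw [← hnat]; exact hsplit.natDegree_eq_card_roots.symm
  obtain ⟨x, hx⟩ : ∃ x : Fin p → ℂ, Finset.univ.val.map x = Q.roots := by
    obtain ⟨l, hl⟩ := Quot.exists_rep Q.roots
    have hl' : (l : Multiset ℂ) = Q.roots := hl
    have hlen : l.length = p := by rw [← hcard, ← hl']; rfl
    subst hlen
    refine ⟨l.get, ?_⟩
    rw [← hl', Fin.univ_val_map, List.ofFn_get]
  have hprod : Q = ∏ h, (Polynomial.X - Polynomial.C (x h)) := by
    have := hsplit.eq_prod_roots_of_monic hmonic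
    rw [← hx, Multiset.map_map] at this
    exact this
  refine ⟨x, fun k => ?_⟩
  obtain ⟨k, hk⟩ := k
  induction k using Nat.strong_induction_on with
  | _ k ih =>
    rw [recurSol_eq]
    by_cases hkp : k < p
    · rw [dif_pos hkp]
    · rw [dif_neg hkp]
      have h1 := congrFun hc ⟨k - p, by omega⟩
      have h2 : p + (k - p) = k := by omega
      simp only [h2] at h1
      rw [← h1]
      simp only [Matrix.mulVec, dotProduct]
      refine Finset.sum_congr rfl fun a _ => ?_
      rw [← hprod, hcoeff, neg_neg, ← ih (k - p + a) (by omega) (by omega), mul_comm]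
      rfl

end Recurrence

/-! ### Almost every data vector is in the image of the moment map -/

section PiMaps

variable {ι κ : Type*} [Fintype ι] [Fintype κ]

theorem measurePreserving_comp_equiv (e : κ ≃ ι) :
    MeasurePreserving fun x : ι → ℂ => x ∘ e := by
  convert! volume_measurePreserving_piCongrLeft (fun _ : κ => ℂ) e.symm using 1
  funext x k
  have h := Equiv.piCongrLeft_apply_apply (fun _ : κ => ℂ) e.symm x (e k)
  rw [e.symm_apply_apply] at h
  exact h.symm

theorem measurePreserving_sumElim :
    MeasurePreserving fun y : (ι → ℂ) × (κ → ℂ) => Sum.elim y.1 y.2 := by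
  convert! volume_measurePreserving_sumPiEquivProdPi_symm (fun _ : ι ⊕ κ => ℂ)

end PiMaps

/-- The determinant is a polynomial in `z` whose coefficient of degree `p` is `R.det`, so it is not
identically zero. -/
theorem finite_singular_pencil {p : ℕ} (A R : Matrix (Fin p) (Fin p) ℂ) (hR : R.det ≠ 0) :
    {z : ℂ | (z • R + A).det = 0}.Finite := by
  set Q : Polynomial ℂ :=
    ((Polynomial.X : Polynomial ℂ) • R.map Polynomial.C + A.map Polynomial.C).det with hQ
  have h0 : Q ≠ 0 := by
    intro h
    have := Polynomial.coeff_det_X_add_C_card R A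
    rw [← hQ, h] at this
    exact hR (by simpa using this.symm)
  refine (Q.roots.toFinset.finite_toSet).subset fun z hz => ?_
  simp only [Finset.mem_coe, Multiset.mem_toFinset]
  rw [Polynomial.mem_roots h0, Polynomial.IsRoot, hQ, ← Polynomial.coe_evalRingHom,
    RingHom.map_det]
  convert! hz.out using 2
  ext a b
  simp [mul_comm z]

theorem ae_det_hankelZero_ne_zero {p : ℕ} (hp : 0 < p) :
    ∀ᵐ d : Fin (2 * p) → ℂ, (hankelZero d).det ≠ 0 := by
  -- The sample `d_{p-1}` fills the antidiagonal of `U₀` and appears nowhere else. With the other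
  -- samples fixed, `U₀` is a pencil in this sample whose leading matrix is the reversal
  -- permutation, an involution; Fubini concludes.
  set j : Fin (2 * p) := ⟨p - 1, by omega⟩ with hj
  have hcont : Continuous fun d : Fin (2 * p) → ℂ => (hankelZero d).det := by
    refine Continuous.matrix_det (continuous_matrix fun a b => ?_)
    simp only [hankelZero, Matrix.of_apply]
    fun_prop
  have hms : MeasurableSet {d : Fin (2 * p) → ℂ | (hankelZero d).det = 0} :=
    hcont.measurable (measurableSet_singleton 0)
  have h1 : volume {d : Fin (2 * p) → ℂ | (hankelZero d).det = 0} = 0 := by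
    rw [← (measurePreserving_insertCoord j).measure_preimage hms.nullMeasurableSet,
      Measure.volume_eq_prod,
      Measure.measure_prod_null ((measurePreserving_insertCoord j).measurable hms)]
    refine Eventually.of_forall fun ζ => ?_
    refine Set.Finite.measure_zero ?_ _
    have hR : (Matrix.of fun a b : Fin p => if (a : ℕ) + b = p - 1 then (1 : ℂ) else 0).det ≠ 0 := by
      set R : Matrix (Fin p) (Fin p) ℂ :=
        Matrix.of fun a b : Fin p => if (a : ℕ) + b = p - 1 then (1 : ℂ) else 0 with hRdef
      have hRR : R * R = 1 := by
        ext a b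
        rw [Matrix.mul_apply, Matrix.one_apply]
        have : ∀ c : Fin p, R a c * R c b = if c = a.rev then R c b else 0 := by
          intro c
          have h : (a : ℕ) + c = p - 1 ↔ c = a.rev := by
            rw [Fin.ext_iff, Fin.val_rev]; omega
          simp only [hRdef, Matrix.of_apply, h, ite_mul, one_mul, zero_mul]
        simp_rw [this]
        rw [Finset.sum_ite_eq' Finset.univ a.rev, if_pos (Finset.mem_univ _)]
        have h : ((a.rev : Fin p) : ℕ) + b = p - 1 ↔ a = b := by
          rw [Fin.ext_iff, Fin.val_rev]; omega
        simp only [hRdef, Matrix.of_apply, h]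
      intro h
      have := congrArg Matrix.det hRR
      simp [h] at this
    refine (finite_singular_pencil (hankelZero (insertCoord j (ζ, 0))) _ hR).subset fun z hz => ?_
    have hz' : (hankelZero (insertCoord j (ζ, z))).det = 0 := hz
    rw [Set.mem_ofPred_eq]
    convert! hz' using 2
    ext a b
    have h : (⟨(a : ℕ) + b, by omega⟩ : Fin (2 * p)) = j ↔ (a : ℕ) + b = p - 1 := by
      rw [hj, Fin.ext_iff]
    simp only [hankelZero, insertCoord, Matrix.add_apply, Matrix.smul_apply, Matrix.of_apply, h]
    split_ifs <;> simp
  filter_upwards [measure_eq_zero_iff_ae_notMem.1 h1] with d hd using hd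

/-- The set is a proper real linear subspace. -/
theorem volume_re_coincidence {ι : Type*} [Fintype ι] (i h : ι) (hne : i ≠ h) :
    volume {v : ι → ℂ | (v i).re = (v h).re} = 0 := by
  classical
  set L : (ι → ℂ) →ₗ[ℝ] ℝ := Complex.reLm.comp (LinearMap.proj i) -
    Complex.reLm.comp (LinearMap.proj h) with hL
  have h1 : {v : ι → ℂ | (v i).re = (v h).re} = (LinearMap.ker L : Set (ι → ℂ)) := by
    ext v
    simp [hL, sub_eq_zero]
  rw [h1]
  refine Measure.addHaar_submodule _ _ fun htop => ?_
  have : (Pi.single i 1 : ι → ℂ) ∈ LinearMap.ker L := htop ▸ Submodule.mem_top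
  simp [hL, hne.symm] at this

theorem exists_perm_strictMono {p : ℕ} {f : Fin p → ℝ} (hf : Function.Injective f) :
    ∃ e : Equiv.Perm (Fin p), StrictMono (f ∘ e) :=
  ⟨Tuple.sort f, (Tuple.monotone_sort f).strictMono_of_injective
    (hf.comp (Tuple.sort f).injective)⟩

theorem measurableSet_sortedParams (p : ℕ) : MeasurableSet (sortedParams p) := by
  have : sortedParams p = (⋂ (i : Fin p) (h : Fin p) (_ : i < h),
      {v | (v (Sum.inl i)).re < (v (Sum.inl h)).re}) ∩ ⋂ h : Fin p, {v | v (Sum.inr h) ≠ 0} := by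
    ext v
    simp [sortedParams, StrictMono]
  rw [this]
  refine MeasurableSet.inter ?_ ?_
  · refine MeasurableSet.iInter fun i => MeasurableSet.iInter fun h => MeasurableSet.iInter fun _ =>
      measurableSet_lt ?_ ?_
    · exact Complex.measurable_re.comp (measurable_pi_apply _)
    · exact Complex.measurable_re.comp (measurable_pi_apply _)
  · exact MeasurableSet.iInter fun h =>
      ((measurableSet_singleton (0 : ℂ)).preimage (measurable_pi_apply _)).compl

/-- Outside a null set `U₀` is invertible, so the data solve a recurrence, and its roots have
distinct real parts. Sorting them and solving the Vandermonde system gives the weights, which are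
nonzero because `det U₀` is their product times a squared Vandermonde determinant. -/
theorem ae_mem_image_momentMap {p : ℕ} (hp : 0 < p) :
    ∀ᵐ d : Fin p ⊕ Fin p → ℂ, d ∈ momentMap '' sortedParams p := by
  have h1 : ∀ᵐ d : Fin p ⊕ Fin p → ℂ, (hankelZero (d ∘ (sampleEquiv p).symm)).det ≠ 0 :=
    (measurePreserving_comp_equiv (sampleEquiv p).symm).quasiMeasurePreserving.ae
      (ae_det_hankelZero_ne_zero hp)
  set N : Set (Fin p ⊕ Fin p → ℂ) :=
    {v | ¬ Function.Injective fun h : Fin p => (v (Sum.inl h)).re} with hN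
  have hN0 : volume N = 0 := by
    have : N ⊆ ⋃ (i : Fin p) (h : Fin p) (_ : i ≠ h),
        {v | (v (Sum.inl i)).re = (v (Sum.inl h)).re} := by
      intro v hv
      simp only [hN, Set.mem_ofPred_eq, Function.Injective, not_forall] at hv
      obtain ⟨i, h, he, hne⟩ := hv
      simp only [Set.mem_iUnion]
      exact ⟨i, h, hne, he⟩
    refine measure_mono_null this ?_
    simp only [measure_iUnion_null_iff]
    exact fun i h hne => volume_re_coincidence _ _ (by simpa using hne)
  -- Roots and initial values, unlike nodes and weights, parametrize the data differentiably across
  -- collisions, and source and target have equal dimension; so the image of the null set `N` is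
  -- null.
  set G : (Fin p ⊕ Fin p → ℂ) → Fin p ⊕ Fin p → ℂ :=
    fun v i => recurSol (v ∘ Sum.inl) (v ∘ Sum.inr) (sampleEquiv p i) with hG
  have hGd : Differentiable ℝ G :=
    (differentiable_pi.2 fun i => differentiable_recurSol _ : Differentiable ℂ G).restrictScalars ℝ
  have h2 : volume (G '' N) = 0 :=
    addHaar_image_eq_zero_of_differentiableOn_of_addHaar_eq_zero volume hGd.differentiableOn hN0
  have h3 : ∀ᵐ d, d ∉ G '' N := measure_eq_zero_iff_ae_notMem.1 h2
  filter_upwards [h1, h3] with d hd1 hd2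
  obtain ⟨x, hx⟩ := exists_eq_recurSol _ hd1
  set u : Fin p → ℂ := fun a => (d ∘ (sampleEquiv p).symm) ⟨a, by omega⟩ with hu
  have hdG : G (Sum.elim x u) = d := by
    funext i
    have := hx (sampleEquiv p i)
    simp only [Function.comp_apply, Equiv.symm_apply_apply] at this
    rw [this]
    simp [hG]
  have hinj : Function.Injective fun h => (x h).re := by
    by_contra hcon
    exact hd2 ⟨Sum.elim x u, hcon, hdG⟩
  obtain ⟨e, he⟩ := exists_perm_strictMono hinj
  have hxe : Function.Injective (x ∘ e) := injective_of_re_injective he.injective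
  have hVdet : (Matrix.vandermonde (x ∘ e)).transpose.det ≠ 0 := by
    rw [Matrix.det_transpose]
    exact Matrix.det_vandermonde_ne_zero_iff.2 hxe
  set γ : Fin p → ℂ := (Matrix.vandermonde (x ∘ e)).transpose⁻¹.mulVec u with hγ
  have hγu : ∀ k : Fin p, ∑ h, γ h * (x ∘ e) h ^ (k : ℕ) = u k := by
    intro k
    have : (Matrix.vandermonde (x ∘ e)).transpose.mulVec γ = u := by
      rw [hγ, Matrix.mulVec_mulVec, Matrix.mul_nonsing_inv _ hVdet.isUnit, Matrix.one_mulVec]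
    rw [← congrFun this k]
    simp [Matrix.mulVec, dotProduct, mul_comm]
  have hds : d ∘ (sampleEquiv p).symm = samples (x ∘ e) γ := by
    funext k
    rw [samples_eq_recurSol _ _ u hγu, recurSol_comp_perm, hx k]
  refine ⟨Sum.elim (x ∘ e) γ, ⟨he, fun h h0 => ?_⟩, ?_⟩
  · rw [hds, det_hankelZero_samples] at hd1
    exact hd1 (by rw [Finset.prod_eq_zero (Finset.mem_univ h) h0, mul_zero])
  · funext i
    have := congrFun hds (sampleEquiv p i)
    simp only [Function.comp_apply, Equiv.symm_apply_apply] at this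
    rw [this]
    simp [momentMap]

/-! ### Area formula and the expected eigenvalue count -/

section Area

variable {p : ℕ}

theorem lintegral_eq_setLIntegral_sortedParams (hp : 0 < p) (g : (Fin p ⊕ Fin p → ℂ) → ENNReal) :
    ∫⁻ d, g d = ∫⁻ v in sortedParams p,
      ENNReal.ofReal (jacNorm (v ∘ Sum.inl) (v ∘ Sum.inr) ^ 2) * g (momentMap v) := by
  have h := lintegral_image_eq_lintegral_abs_det_fderiv_mul (volume : Measure (Fin p ⊕ Fin p → ℂ))
    (measurableSet_sortedParams p) (fun v _ => (hasFDerivAt_momentMap v).hasFDerivWithinAt)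
    (injOn_momentMap p) g
  rw [Measure.restrict_eq_self_of_ae_mem (ae_mem_image_momentMap hp)] at h
  rw [h]
  refine lintegral_congr fun v => ?_
  rw [abs_det_fderiv_momentMap]

/-- The simultaneous permutations of nodes and weights carry the sorted domain onto `p!` disjoint
chambers, which cover almost everything where `Φ` does not vanish. -/
theorem lintegral_eq_factorial_mul (Φ : (Fin p ⊕ Fin p → ℂ) → ENNReal) (hΦ : Measurable Φ)
    (hsymm : ∀ v (e : Equiv.Perm (Fin p)), Φ (v ∘ Equiv.sumCongr e e) = Φ v)
    (hzero : ∀ v : Fin p ⊕ Fin p → ℂ, (∃ h, v (Sum.inr h) = 0) → Φ v = 0) :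
    ∫⁻ v, Φ v = (p.factorial : ENNReal) * ∫⁻ v in sortedParams p, Φ v := by
  have hmp : ∀ e : Equiv.Perm (Fin p),
      MeasurePreserving fun v : Fin p ⊕ Fin p → ℂ => v ∘ Equiv.sumCongr e e :=
    fun e => measurePreserving_comp_equiv _
  have hind : Measurable ((sortedParams p).indicator Φ) :=
    hΦ.indicator (measurableSet_sortedParams p)
  have hinj : ∀ᵐ v : Fin p ⊕ Fin p → ℂ, Function.Injective fun h => (v (Sum.inl h)).re := by
    have h1 : ∀ i h : Fin p, i ≠ h →
        ∀ᵐ v : Fin p ⊕ Fin p → ℂ, (v (Sum.inl i)).re ≠ (v (Sum.inl h)).re := by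
      intro i h hne
      filter_upwards [measure_eq_zero_iff_ae_notMem.1
        (volume_re_coincidence (Sum.inl i : Fin p ⊕ Fin p) (Sum.inl h) (by simpa using hne))]
        with v hv using hv
    have h2 : ∀ᵐ v : Fin p ⊕ Fin p → ℂ, ∀ i h : Fin p, i ≠ h →
        (v (Sum.inl i)).re ≠ (v (Sum.inl h)).re := by
      simp only [ae_all_iff, eventually_imp_distrib_left]
      exact h1
    filter_upwards [h2] with v hv i h hih
    by_contra hne
    exact hv i h hne hih
  have hsum : ∀ᵐ v : Fin p ⊕ Fin p → ℂ,
      Φ v = ∑ e : Equiv.Perm (Fin p), (sortedParams p).indicator Φ (v ∘ Equiv.sumCongr e e) := by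
    filter_upwards [hinj] with v hv
    obtain ⟨e, he⟩ := exists_perm_strictMono hv
    by_cases hz : ∃ h, v (Sum.inr h) = 0
    · rw [hzero v hz]
      refine (Finset.sum_eq_zero fun e _ => ?_).symm
      refine Set.indicator_of_notMem (fun hm => ?_) _
      obtain ⟨h, hh⟩ := hz
      refine hm.2 (e.symm h) ?_
      simpa using hh
    · push Not at hz
      rw [Finset.sum_eq_single e]
      · rw [Set.indicator_of_mem, hsymm]
        exact ⟨he, fun h => by simpa using hz (e h)⟩
      · intro e' _ hne
        refine Set.indicator_of_notMem (fun hm => hne ?_) _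
        have h1 : StrictMono ((fun h => (v (Sum.inl h)).re) ∘ e') := hm.1
        have h2 := (h1.range_inj he).1 (by
          rw [Set.range_comp, Set.range_comp, e'.surjective.range_eq, e.surjective.range_eq])
        ext1 i
        exact hv (congrFun h2 i)
      · simp
  have hterm : ∀ e ∈ (Finset.univ : Finset (Equiv.Perm (Fin p))), Measurable
      fun v : Fin p ⊕ Fin p → ℂ => (sortedParams p).indicator Φ (v ∘ Equiv.sumCongr e e) :=
    fun e _ => hind.comp (hmp e).measurable
  rw [lintegral_congr_ae hsum, lintegral_finsetSum _ hterm,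
    Finset.sum_congr rfl fun e _ => (hmp e).lintegral_comp hind, Finset.sum_const,
    lintegral_indicator (measurableSet_sortedParams p)]
  simp [Fintype.card_perm]

/-- Number of generalized eigenvalues in `A`, with multiplicity, of the pencil built on `d`. -/
noncomputable def eigenvalueCount (A : Set ℂ) (d : Fin (2 * p) → ℂ) : ENNReal :=
  ((generalizedEigenvalues (hankelOne d) (hankelZero d)).map fun x => Measure.dirac x).sum A

theorem eigenvalueCount_samples {A : Set ℂ} (hA : MeasurableSet A) (x γ : Fin p → ℂ)
    (hx : Function.Injective x) (hγ : ∀ h, γ h ≠ 0) :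
    eigenvalueCount A (samples x γ) = ∑ h, A.indicator 1 (x h) := by
  rw [eigenvalueCount, generalizedEigenvalues_samples x γ hx hγ, Multiset.map_map]
  have : (Finset.univ.val.map ((fun x => Measure.dirac x) ∘ x)).sum =
      ∑ h, Measure.dirac (x h) := rfl
  rw [this, Measure.finsetSum_apply]
  exact Finset.sum_congr rfl fun h _ => Measure.dirac_apply' _ hA

theorem momentMap_comp_symm (v : Fin p ⊕ Fin p → ℂ) :
    momentMap v ∘ (sampleEquiv p).symm = samples (v ∘ Sum.inl) (v ∘ Sum.inr) := by
  funext k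
  simp [momentMap]

theorem eigenvalueCount_momentMap {A : Set ℂ} (hA : MeasurableSet A) {v : Fin p ⊕ Fin p → ℂ}
    (hv : v ∈ sortedParams p) :
    eigenvalueCount A (momentMap v ∘ (sampleEquiv p).symm) =
      ∑ h, A.indicator 1 (v (Sum.inl h)) := by
  rw [momentMap_comp_symm, eigenvalueCount_samples hA (v ∘ Sum.inl) (v ∘ Sum.inr)
    (injective_of_re_injective hv.1.injective) hv.2]
  rfl

theorem continuous_momentMap : Continuous (momentMap (p := p)) :=
  continuous_iff_continuousAt.2 fun v => (hasFDerivAt_momentMap v).continuousAt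

theorem measurable_nodeCount {A : Set ℂ} (hA : MeasurableSet A) :
    Measurable fun v : Fin p ⊕ Fin p → ℂ => ∑ h, A.indicator (1 : ℂ → ENNReal) (v (Sum.inl h)) :=
  Finset.measurable_sum _ fun _ _ => (measurable_one.indicator hA).comp (measurable_pi_apply _)

theorem aemeasurable_eigenvalueCount_comp (hp : 0 < p) {A : Set ℂ} (hA : MeasurableSet A) :
    AEMeasurable fun d : Fin p ⊕ Fin p → ℂ => eigenvalueCount A (d ∘ (sampleEquiv p).symm) := by
  have : StandardBorelSpace (sortedParams p) := (measurableSet_sortedParams p).standardBorel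
  -- Lusin–Souslin: an injective Borel map on a standard Borel space is a measurable embedding. So
  -- the node count transports to the data, with no need to know that polynomial roots depend
  -- measurably on coefficients.
  have hemb : MeasurableEmbedding ((sortedParams p).domRestrict momentMap) :=
    (continuous_momentMap.measurable.comp measurable_subtype_coe).measurableEmbedding
      (Set.injOn_iff_injective.1 (injOn_momentMap p))
  obtain ⟨g, hg, hgc⟩ := hemb.exists_measurable_extend
    ((measurable_nodeCount hA).comp measurable_subtype_coe) fun _ => ⟨0⟩
  refine ⟨g, hg, ?_⟩
  filter_upwards [ae_mem_image_momentMap hp] with d hd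
  obtain ⟨v, hv, rfl⟩ := hd
  rw [eigenvalueCount_momentMap hA hv]
  exact (congrFun hgc ⟨v, hv⟩).symm

theorem aemeasurable_eigenvalueCount (hp : 0 < p) {A : Set ℂ} (hA : MeasurableSet A) :
    AEMeasurable (eigenvalueCount (p := p) A) := by
  have h := (aemeasurable_eigenvalueCount_comp hp hA).comp_quasiMeasurePreserving
    (measurePreserving_comp_equiv (sampleEquiv p)).quasiMeasurePreserving
  refine h.congr (Eventually.of_forall fun d => ?_)
  simp only [Function.comp_apply]
  congr 1
  funext k
  simp

/-- `∫ ∫ jointKernel dγ dζ` over all nodes but `x_j = z`. -/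
noncomputable def kernelMass (j : Fin p) (s : Fin (2 * p) → ℂ) (σ : ℝ) (z : ℂ) : ENNReal :=
  ∫⁻ ζ : {h : Fin p // h ≠ j} → ℂ, ∫⁻ γ : Fin p → ℂ,
    ENNReal.ofReal (jointKernel s σ (nodes j ζ z) γ)

/-- Tonelli with `x_j` as the outermost variable: `kernelMass j` is the unnormalized marginal of the
`j`-th node. -/
theorem setLIntegral_kernelMass (j : Fin p) (s : Fin (2 * p) → ℂ) (σ : ℝ) {A : Set ℂ}
    (hA : MeasurableSet A) :
    ∫⁻ z in A, kernelMass j s σ z = ∫⁻ v : Fin p ⊕ Fin p → ℂ, A.indicator 1 (v (Sum.inl j)) *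
      ENNReal.ofReal (jointKernel s σ (v ∘ Sum.inl) (v ∘ Sum.inr)) := by
  have hK : Measurable fun y : (Fin p → ℂ) × (Fin p → ℂ) =>
      ENNReal.ofReal (jointKernel s σ y.1 y.2) :=
    (continuous_jointKernel s σ).measurable.ennreal_ofReal
  have hI : Measurable (A.indicator (1 : ℂ → ENNReal)) := measurable_one.indicator hA
  have hmeas : Measurable fun v : Fin p ⊕ Fin p → ℂ => A.indicator 1 (v (Sum.inl j)) *
      ENNReal.ofReal (jointKernel s σ (v ∘ Sum.inl) (v ∘ Sum.inr)) := by
    refine (hI.comp (measurable_pi_apply _)).mul ?_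
    exact hK.comp (f := fun v : Fin p ⊕ Fin p → ℂ => (v ∘ Sum.inl, v ∘ Sum.inr)) (by fun_prop)
  have hN := measurePreserving_nodes j
  rw [← measurePreserving_sumElim.lintegral_comp hmeas]
  simp only [Sum.elim_comp_inl, Sum.elim_comp_inr, Sum.elim_inl]
  have hm2 : Measurable fun y : (Fin p → ℂ) × (Fin p → ℂ) => A.indicator 1 (y.1 j) *
      ENNReal.ofReal (jointKernel s σ y.1 y.2) :=
    (hI.comp ((measurable_pi_apply j).comp measurable_fst)).mul hK
  rw [Measure.volume_eq_prod, lintegral_prod _ hm2.aemeasurable]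
  have hm3 : Measurable fun x : Fin p → ℂ => ∫⁻ γ : Fin p → ℂ, A.indicator 1 (x j) *
      ENNReal.ofReal (jointKernel s σ x γ) := hm2.lintegral_prod_right'
  have hm4 : Measurable fun y : ({h : Fin p // h ≠ j} → ℂ) × ℂ =>
      ∫⁻ γ : Fin p → ℂ, A.indicator 1 (nodes j y.1 y.2 j) *
        ENNReal.ofReal (jointKernel s σ (nodes j y.1 y.2) γ) := hm3.comp hN.measurable
  rw [← hN.lintegral_comp hm3, Measure.volume_eq_prod, lintegral_prod_symm' _ hm4,
    ← lintegral_indicator hA]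
  refine lintegral_congr fun z => ?_
  have hj : ∀ ζ, nodes j ζ z j = z := fun ζ => by simp [nodes]
  simp only [hj]
  by_cases hz : z ∈ A <;> simp [hz, kernelMass]

/-- In sorted coordinates the count is the sum over `j` of the indicators of `x_j ∈ A`. The
integrand is symmetric, so removing the sorting constraint costs exactly the factor `p!`. -/
theorem lintegral_eigenvalueCount_mul (hp : 0 < p) (σ : ℝ) {A : Set ℂ} (hA : MeasurableSet A) :
    ∫⁻ d : Fin (2 * p) → ℂ, eigenvalueCount A d *
        ENNReal.ofReal (Real.exp (-(1 / σ ^ 2) * ∑ k, ‖d k‖ ^ 2)) =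
      (p.factorial : ENNReal)⁻¹ * ∑ j : Fin p, ∫⁻ z in A, kernelMass j 0 σ z := by
  have hK : Measurable fun v : Fin p ⊕ Fin p → ℂ =>
      ENNReal.ofReal (jointKernel 0 σ (v ∘ Sum.inl) (v ∘ Sum.inr)) :=
    (continuous_jointKernel 0 σ).measurable.ennreal_ofReal.comp
      (f := fun v : Fin p ⊕ Fin p → ℂ => (v ∘ Sum.inl, v ∘ Sum.inr)) (by fun_prop)
  have hI : Measurable (A.indicator (1 : ℂ → ENNReal)) := measurable_one.indicator hA
  simp_rw [setLIntegral_kernelMass _ _ _ hA]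
  have hterm : ∀ j ∈ (Finset.univ : Finset (Fin p)), Measurable fun v : Fin p ⊕ Fin p → ℂ =>
      A.indicator 1 (v (Sum.inl j)) *
        ENNReal.ofReal (jointKernel 0 σ (v ∘ Sum.inl) (v ∘ Sum.inr)) :=
    fun j _ => (hI.comp (measurable_pi_apply _)).mul hK
  rw [← lintegral_finsetSum _ hterm]
  simp_rw [← Finset.sum_mul]
  rw [lintegral_eq_factorial_mul, ← mul_assoc, ENNReal.inv_mul_cancel
    (by exact_mod_cast p.factorial_ne_zero) (ENNReal.natCast_ne_top _), one_mul]
  · have hpres := volume_measurePreserving_piCongrLeft (fun _ : Fin (2 * p) => ℂ) (sampleEquiv p)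
    rw [← hpres.lintegral_comp_emb (MeasurableEquiv.measurableEmbedding _),
      lintegral_eq_setLIntegral_sortedParams hp]
    refine setLIntegral_congr_fun (measurableSet_sortedParams p) fun v hv => ?_
    have hpc : MeasurableEquiv.piCongrLeft (fun _ : Fin (2 * p) => ℂ) (sampleEquiv p)
        (momentMap v) = momentMap v ∘ (sampleEquiv p).symm := by
      funext k
      have h := Equiv.piCongrLeft_apply_apply (fun _ : Fin (2 * p) => ℂ) (sampleEquiv p)
        (momentMap v) ((sampleEquiv p).symm k)
      rw [Equiv.apply_symm_apply] at h
      exact h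
    rw [hpc, eigenvalueCount_momentMap hA hv, momentMap_comp_symm, jointKernel,
      ENNReal.ofReal_mul (by positivity)]
    simp only [Pi.zero_apply, sub_zero]
    ring
  · exact (measurable_nodeCount hA).mul hK
  · intro v e
    have h1 : (v ∘ Equiv.sumCongr e e) ∘ Sum.inl = (v ∘ Sum.inl) ∘ e := rfl
    have h2 : (v ∘ Equiv.sumCongr e e) ∘ Sum.inr = (v ∘ Sum.inr) ∘ e := rfl
    rw [h1, h2, jointKernel_comp_equiv]
    congr 1
    exact Equiv.sum_comp e fun h => A.indicator 1 (v (Sum.inl h))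
  · rintro v ⟨h, hh⟩
    have : jacNorm (v ∘ Sum.inl) (v ∘ Sum.inr) = 0 := by
      rw [jacNorm, Finset.prod_eq_zero (Finset.mem_univ h) (by simp [hh]), zero_mul]
    simp [jointKernel, this]

end Area

/-! ### Gaussian bounds and finiteness of the marginals -/

section Gaussian

theorem integrable_exp_neg_mul_norm_sq {b : ℝ} (hb : 0 < b) :
    Integrable fun w : ℂ => Real.exp (-b * ‖w‖ ^ 2) := by
  have h := GaussianFourier.integrable_cexp_neg_mul_sq_norm_add (V := ℂ) (b := (b : ℂ))
    (by simpa using hb) 0 0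
  refine h.norm.congr (Eventually.of_forall fun w => ?_)
  simp only [zero_mul, add_zero, Complex.norm_exp]
  congr 1
  rw [← Complex.ofReal_neg, ← Complex.ofReal_pow, ← Complex.ofReal_mul, Complex.ofReal_re]

theorem integrable_exp_neg_mul_sum_norm_sq {ι : Type*} [Fintype ι] {b : ℝ} (hb : 0 < b) :
    Integrable fun d : ι → ℂ => Real.exp (-b * ∑ k, ‖d k‖ ^ 2) := by
  have h := Integrable.fintype_prod (ι := ι) (μ := fun _ => (volume : Measure ℂ))
    fun _ => integrable_exp_neg_mul_norm_sq hb
  refine h.congr (Eventually.of_forall fun d => ?_)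
  simp only [Finset.mul_sum, Real.exp_sum]

end Gaussian

section Finiteness

variable {p : ℕ}

theorem eigenvalueCount_univ_ae (hp : 0 < p) :
    ∀ᵐ d : Fin (2 * p) → ℂ, eigenvalueCount Set.univ d = p := by
  have h := (measurePreserving_comp_equiv (sampleEquiv p)).quasiMeasurePreserving.ae
    (ae_mem_image_momentMap hp)
  filter_upwards [h] with d hd
  obtain ⟨v, hv, hvd⟩ := hd
  have h1 : d = momentMap v ∘ (sampleEquiv p).symm := by
    rw [hvd]; funext k; simp
  rw [h1, eigenvalueCount_momentMap MeasurableSet.univ hv]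
  simp

theorem Continuous.jointKernel {α : Type*} [TopologicalSpace α] {f g : α → Fin p → ℂ}
    (hf : Continuous f) (hg : Continuous g) (s : Fin (2 * p) → ℂ) (σ : ℝ) :
    Continuous fun a => jointKernel s σ (f a) (g a) :=
  (continuous_jointKernel s σ).comp (hf.prodMk hg)

theorem Continuous.nodes {α : Type*} [TopologicalSpace α] {j : Fin p}
    {f : α → {h : Fin p // h ≠ j} → ℂ} {g : α → ℂ} (hf : Continuous f) (hg : Continuous g) :
    Continuous fun a => nodes j (f a) (g a) :=
  (continuous_nodes j).comp (hf.prodMk hg)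

theorem measurable_kernelMass (j : Fin p) (s : Fin (2 * p) → ℂ) (σ : ℝ) :
    Measurable (kernelMass j s σ) := by
  have hcont : Continuous fun y : (ℂ × ({h : Fin p // h ≠ j} → ℂ)) × (Fin p → ℂ) =>
      _root_.jointKernel s σ (_root_.nodes j y.1.2 y.1.1) y.2 :=
    ((continuous_snd.comp continuous_fst).nodes (continuous_fst.comp continuous_fst)).jointKernel
      continuous_snd s σ
  have h1 : Measurable fun y : ℂ × ({h : Fin p // h ≠ j} → ℂ) => ∫⁻ γ : Fin p → ℂ,
      ENNReal.ofReal (_root_.jointKernel s σ (_root_.nodes j y.2 y.1) γ) :=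
    hcont.measurable.ennreal_ofReal.lintegral_prod_right'
  exact h1.lintegral_prod_right'

/-- Take `A` to be the whole plane: the count is almost everywhere `p`, so the marginals have finite
total integral. -/
theorem ae_kernelMass_lt_top (hp : 0 < p) (j : Fin p) {σ : ℝ} (hσ : 0 < σ) :
    ∀ᵐ z, kernelMass j 0 σ z < ⊤ := by
  have h := lintegral_eigenvalueCount_mul hp σ MeasurableSet.univ
  have hfin : ∫⁻ d : Fin (2 * p) → ℂ, eigenvalueCount Set.univ d *
      ENNReal.ofReal (Real.exp (-(1 / σ ^ 2) * ∑ k, ‖d k‖ ^ 2)) < ⊤ := by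
    have h1 : ∫⁻ d : Fin (2 * p) → ℂ, eigenvalueCount Set.univ d *
        ENNReal.ofReal (Real.exp (-(1 / σ ^ 2) * ∑ k, ‖d k‖ ^ 2)) =
        ∫⁻ d : Fin (2 * p) → ℂ, (p : ENNReal) *
        ENNReal.ofReal (Real.exp (-(1 / σ ^ 2) * ∑ k, ‖d k‖ ^ 2)) := by
      refine lintegral_congr_ae ?_
      filter_upwards [eigenvalueCount_univ_ae hp] with d hd
      rw [hd]
    rw [h1, lintegral_const_mul' _ _ (ENNReal.natCast_ne_top p)]
    refine ENNReal.mul_lt_top (ENNReal.natCast_lt_top p) ?_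
    have hi := (integrable_exp_neg_mul_sum_norm_sq (ι := Fin (2 * p))
      (b := 1 / σ ^ 2) (by positivity)).hasFiniteIntegral
    rwa [hasFiniteIntegral_iff_ofReal (Eventually.of_forall fun d => (Real.exp_pos _).le)] at hi
  rw [h] at hfin
  have hsum : ∑ j : Fin p, ∫⁻ z in Set.univ, kernelMass j 0 σ z ≠ ⊤ := by
    intro htop
    rw [htop, ENNReal.mul_top (ENNReal.inv_ne_zero.2 (ENNReal.natCast_ne_top _))] at hfin
    exact lt_irrefl _ hfin
  have hj := (ENNReal.sum_ne_top.1 hsum) j (Finset.mem_univ j)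
  rw [Measure.restrict_univ] at hj
  exact ae_lt_top (measurable_kernelMass j 0 σ) hj

theorem samples_add_const (x γ : Fin p → ℂ) (b : ℂ) (k : Fin (2 * p)) :
    samples (fun i => x i + b) γ k = ∑ i ∈ Finset.range (k + 1),
      b ^ ((k : ℕ) - i) * ((k : ℕ).choose i : ℂ) * ∑ h, γ h * x h ^ i := by
  simp only [samples, add_pow, Finset.mul_sum]
  rw [Finset.sum_comm]
  exact Finset.sum_congr rfl fun i _ => Finset.sum_congr rfl fun h _ => by ring

/-- Translating the nodes acts on the samples by a binomial matrix. Row `k` has absolute sum at most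
`2 ^ k`, hence a factor `4 ^ (2p)` per squared sample, and there are `2p` of them. -/
theorem sum_norm_samples_add_const_le (x γ : Fin p → ℂ) {b : ℂ} (hb : ‖b‖ ≤ 1) :
    ∑ k, ‖samples (fun i => x i + b) γ k‖ ^ 2 ≤
      (2 * p : ℕ) * 4 ^ (2 * p) * ∑ k, ‖samples x γ k‖ ^ 2 := by
  set S : ℝ := ∑ k, ‖samples x γ k‖ ^ 2 with hS
  have hS0 : 0 ≤ S := Finset.sum_nonneg fun _ _ => by positivity
  have hk : ∀ k : Fin (2 * p), ‖samples (fun i => x i + b) γ k‖ ^ 2 ≤ 4 ^ (2 * p) * S := by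
    intro k
    have h1 : ‖samples (fun i => x i + b) γ k‖ ≤ 2 ^ (k : ℕ) * √S := by
      rw [samples_add_const]
      have h2 : ((2 : ℝ) ^ (k : ℕ)) = ∑ i ∈ Finset.range ((k : ℕ) + 1), ((k : ℕ).choose i : ℝ) := by
        exact_mod_cast (Nat.sum_range_choose (k : ℕ)).symm
      rw [h2, Finset.sum_mul]
      refine norm_sum_le_of_le _ fun i hi => ?_
      rw [norm_mul, norm_mul, norm_pow, Complex.norm_natCast]
      have h3 : ‖∑ h, γ h * x h ^ i‖ ≤ √S := by
        have hi' : i < 2 * p := by have := Finset.mem_range.1 hi; omega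
        have h5 : ‖samples x γ ⟨i, hi'⟩‖ ^ 2 ≤ S := Finset.single_le_sum
          (f := fun k => ‖samples x γ k‖ ^ 2) (fun _ _ => by positivity) (Finset.mem_univ _)
        exact Real.le_sqrt_of_sq_le h5
      have h4 : ‖b‖ ^ ((k : ℕ) - i) ≤ 1 := pow_le_one₀ (norm_nonneg _) hb
      refine mul_le_mul ?_ h3 (norm_nonneg _) (by positivity)
      exact mul_le_of_le_one_left (by positivity) h4
    calc ‖samples (fun i => x i + b) γ k‖ ^ 2 ≤ (2 ^ (k : ℕ) * √S) ^ 2 := by gcongr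
      _ = 4 ^ (k : ℕ) * S := by
        rw [mul_pow, Real.sq_sqrt hS0, ← pow_mul, mul_comm (k : ℕ) 2, pow_mul]; norm_num
      _ ≤ 4 ^ (2 * p) * S := by
        gcongr
        · norm_num
        · exact k.2.le
  calc _ ≤ ∑ _k : Fin (2 * p), 4 ^ (2 * p) * S := Finset.sum_le_sum fun k _ => hk k
    _ = _ := by simp; ring

theorem jacNorm_add_const (x γ : Fin p → ℂ) (b : ℂ) :
    jacNorm (fun i => x i + b) γ = jacNorm x γ := by
  rw [jacNorm, jacNorm, spread_add_const]

theorem nodes_add_const (j : Fin p) (ζ : {h : Fin p // h ≠ j} → ℂ) (z b : ℂ) :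
    nodes j (fun i => ζ i + b) (z + b) = fun i => nodes j ζ z i + b := by
  funext i
  by_cases h : i = j <;> simp [nodes, h]

/-- Translation of all nodes preserves the Jacobian and distorts the exponent by at most a constant,
which a larger `σ` absorbs. Finiteness at one nearby point therefore gives finiteness at `z`. -/
theorem kernelMass_lt_top (hp : 0 < p) (j : Fin p) {σ : ℝ} (hσ : 0 < σ) (z : ℂ) :
    kernelMass j 0 σ z < ⊤ := by
  set C : ℝ := (2 * p : ℕ) * 4 ^ (2 * p) with hC
  have hC0 : 0 < C := by
    have : (0 : ℝ) < (2 * p : ℕ) := by exact_mod_cast (by omega : 0 < 2 * p)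
    positivity
  -- The unit ball has positive measure, so it meets the full-measure set of finiteness at level `√C
  -- * σ`.
  obtain ⟨z', hz', hfin⟩ : ∃ z' ∈ Metric.ball z 1, kernelMass j 0 (√C * σ) z' < ⊤ := by
    have h := ae_kernelMass_lt_top hp j (σ := √C * σ) (by positivity)
    by_contra! hcon
    have h0 : volume (Metric.ball z 1) = 0 :=
      measure_mono_null (fun z' hz' => (hcon z' hz').not_gt) (ae_iff.1 h)
    exact (Metric.measure_ball_pos volume z one_pos).ne' h0
  refine lt_of_le_of_lt ?_ hfin
  set b : ℂ := z - z' with hb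
  have hb1 : ‖-b‖ ≤ 1 := by
    rw [norm_neg, hb, ← dist_eq_norm, dist_comm]
    exact (Metric.mem_ball.1 hz').le
  have hz : z = z' + b := by rw [hb]; ring
  have hshift : kernelMass j 0 σ z = ∫⁻ ζ : {h : Fin p // h ≠ j} → ℂ, ∫⁻ γ : Fin p → ℂ,
      ENNReal.ofReal (jointKernel 0 σ (fun i => nodes j ζ z' i + b) γ) := by
    rw [kernelMass, ← lintegral_add_right_eq_self _ (fun _ : {h : Fin p // h ≠ j} => b)]
    refine lintegral_congr fun ζ => lintegral_congr fun γ => ?_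
    rw [← nodes_add_const, ← hz]
    rfl
  rw [hshift]
  refine lintegral_mono fun ζ => lintegral_mono fun γ => ENNReal.ofReal_le_ofReal ?_
  rw [jointKernel, jointKernel, jacNorm_add_const]
  refine mul_le_mul_of_nonneg_left (Real.exp_le_exp.2 ?_) (by positivity)
  have h := sum_norm_samples_add_const_le (fun i => nodes j ζ z' i + b) γ hb1
  simp only [add_neg_cancel_right] at h
  simp only [Pi.zero_apply, sub_zero]
  rw [mul_pow, Real.sq_sqrt hC0.le, neg_mul, neg_mul, neg_le_neg_iff, one_div_mul_eq_div,
    one_div_mul_eq_div, div_le_div_iff₀ (by positivity) (by positivity)]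
  rw [← hC] at h
  nlinarith [mul_le_mul_of_nonneg_right h (sq_nonneg σ)]

theorem continuous_marginalIntegrand (j : Fin p) (s : Fin (2 * p) → ℂ) (z : ℂ) (σ : ℝ) :
    Continuous fun y : ({h : Fin p // h ≠ j} → ℂ) × (Fin p → ℂ) =>
      marginalIntegrand j s z σ y.1 y.2 := by
  simp_rw [marginalIntegrand_eq]
  exact (continuous_fst.nodes continuous_const).jointKernel continuous_snd s σ

theorem marginalIntegrand_nonneg (j : Fin p) (s : Fin (2 * p) → ℂ) (z : ℂ) (σ : ℝ)
    (ζ : {h : Fin p // h ≠ j} → ℂ) (γ : Fin p → ℂ) : 0 ≤ marginalIntegrand j s z σ ζ γ := by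
  rw [marginalIntegrand_eq]; exact jointKernel_nonneg _ _ _ _

theorem lintegral_marginalIntegrand (j : Fin p) (s : Fin (2 * p) → ℂ) (z : ℂ) (σ : ℝ) :
    ∫⁻ y : ({h : Fin p // h ≠ j} → ℂ) × (Fin p → ℂ),
      ENNReal.ofReal (marginalIntegrand j s z σ y.1 y.2) = kernelMass j s σ z := by
  have hm : Measurable fun y : ({h : Fin p // h ≠ j} → ℂ) × (Fin p → ℂ) =>
      ENNReal.ofReal (marginalIntegrand j s z σ y.1 y.2) :=
    (continuous_marginalIntegrand j s z σ).measurable.ennreal_ofReal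
  rw [Measure.volume_eq_prod, lintegral_prod _ hm.aemeasurable, kernelMass]
  refine lintegral_congr fun ζ => lintegral_congr fun γ => ?_
  rw [marginalIntegrand_eq]

theorem integrable_marginalIntegrand_zero (hp : 0 < p) (j : Fin p) (z : ℂ) {σ : ℝ} (hσ : 0 < σ) :
    Integrable fun y : ({h : Fin p // h ≠ j} → ℂ) × (Fin p → ℂ) =>
      marginalIntegrand j 0 z σ y.1 y.2 := by
  refine ⟨(continuous_marginalIntegrand j 0 z σ).aestronglyMeasurable, ?_⟩
  have h0 : 0 ≤ᵐ[volume] fun y : ({h : Fin p // h ≠ j} → ℂ) × (Fin p → ℂ) =>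
      marginalIntegrand j 0 z σ y.1 y.2 :=
    Eventually.of_forall fun y => marginalIntegrand_nonneg j 0 z σ y.1 y.2
  rw [hasFiniteIntegral_iff_ofReal h0, lintegral_marginalIntegrand]
  exact kernelMass_lt_top hp j hσ z

/-- From `‖a‖² ≤ 2‖a - s‖² + 2‖s‖²`: a signal costs a constant factor and `σ` becomes `√2 σ`. This
reduces integrability, and later domination, to pure noise. -/
theorem jointKernel_le (s : Fin (2 * p) → ℂ) {σ : ℝ} (hσ : 0 < σ) (x γ : Fin p → ℂ) :
    jointKernel s σ x γ ≤
      Real.exp (1 / σ ^ 2 * ∑ k, ‖s k‖ ^ 2) * jointKernel 0 (√2 * σ) x γ := by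
  rw [jointKernel, jointKernel, mul_left_comm, ← Real.exp_add]
  refine mul_le_mul_of_nonneg_left (Real.exp_le_exp.2 ?_) (by positivity)
  simp only [Pi.zero_apply, sub_zero]
  have h1 : ∑ k, ‖samples x γ k‖ ^ 2 ≤
      2 * ∑ k, ‖samples x γ k - s k‖ ^ 2 + 2 * ∑ k, ‖s k‖ ^ 2 := by
    rw [Finset.mul_sum, Finset.mul_sum, ← Finset.sum_add_distrib]
    refine Finset.sum_le_sum fun k _ => ?_
    have h2 : ‖samples x γ k‖ ≤ ‖samples x γ k - s k‖ + ‖s k‖ := by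
      simpa using norm_add_le (samples x γ k - s k) (s k)
    have h3 := norm_nonneg (samples x γ k)
    nlinarith [sq_nonneg (‖samples x γ k - s k‖ - ‖s k‖)]
  rw [mul_pow, Real.sq_sqrt (by norm_num)]
  have h4 : 1 / (2 * σ ^ 2) = (1 / σ ^ 2) / 2 := by field_simp
  have h5 : (0 : ℝ) < 1 / σ ^ 2 := by positivity
  rw [h4]
  nlinarith [mul_le_mul_of_nonneg_left h1 h5.le]

theorem marginalIntegrand_le (j : Fin p) (s : Fin (2 * p) → ℂ) (z : ℂ) {σ : ℝ} (hσ : 0 < σ)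
    (ζ : {h : Fin p // h ≠ j} → ℂ) (γ : Fin p → ℂ) :
    marginalIntegrand j s z σ ζ γ ≤
      Real.exp (1 / σ ^ 2 * ∑ k, ‖s k‖ ^ 2) * marginalIntegrand j 0 z (√2 * σ) ζ γ := by
  rw [marginalIntegrand_eq, marginalIntegrand_eq]
  exact jointKernel_le s hσ _ _

theorem integrable_marginalIntegrand (hp : 0 < p) (j : Fin p) (s : Fin (2 * p) → ℂ) (z : ℂ)
    {σ : ℝ} (hσ : 0 < σ) :
    Integrable fun y : ({h : Fin p // h ≠ j} → ℂ) × (Fin p → ℂ) =>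
      marginalIntegrand j s z σ y.1 y.2 := by
  refine ((integrable_marginalIntegrand_zero hp j z (σ := √2 * σ) (by positivity)).const_mul
    (Real.exp (1 / σ ^ 2 * ∑ k, ‖s k‖ ^ 2))).mono'
    (continuous_marginalIntegrand j s z σ).aestronglyMeasurable (Eventually.of_forall fun y => ?_)
  rw [Real.norm_of_nonneg (marginalIntegrand_nonneg _ _ _ _ _ _)]
  exact marginalIntegrand_le j s z hσ _ _

end Finiteness

section MeasurableEmbeddings

theorem measurableEmbedding_comp_equiv {ι κ : Type*} (e : κ ≃ ι) :
    MeasurableEmbedding fun x : ι → ℂ => x ∘ e := by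
  convert! (MeasurableEquiv.piCongrLeft (fun _ : κ => ℂ) e.symm).measurableEmbedding using 1
  funext x k
  have h := Equiv.piCongrLeft_apply_apply (fun _ : κ => ℂ) e.symm x (e k)
  rw [e.symm_apply_apply] at h
  exact h.symm

theorem integral_comp_equiv {ι κ : Type*} [Fintype ι] [Fintype κ] (e : κ ≃ ι) (f : (κ → ℂ) → ℝ) :
    ∫ x : ι → ℂ, f (x ∘ e) = ∫ x, f x :=
  (measurePreserving_comp_equiv e).integral_comp (measurableEmbedding_comp_equiv e) f

theorem integral_comp_rotation {ι : Type*} [Fintype ι] (a : Circle) (f : (ι → ℂ) → ℝ) :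
    ∫ x : ι → ℂ, f (fun i => a * x i) = ∫ x, f x := by
  have h1 : MeasurePreserving fun (x : ι → ℂ) i => rotation a (x i) :=
    volume_preserving_pi fun _ => (rotation a).measurePreserving
  have h2 : MeasurableEmbedding fun (x : ι → ℂ) i => rotation a (x i) :=
    (MeasurableEquiv.piCongrRight fun _ : ι =>
      (rotation a).toHomeomorph.toMeasurableEquiv).measurableEmbedding
  exact h1.integral_comp h2 f

end MeasurableEmbeddings

/-! ### Scaling, limit and symmetries of the marginal density -/

section Marginal

variable {p : ℕ}

theorem marginalDensity_eq_integral_prod (hp : 0 < p) (j : Fin p) (s : Fin (2 * p) → ℂ) (z : ℂ)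
    {σ : ℝ} (hσ : 0 < σ) :
    marginalDensity j s z σ = 1 / (Real.pi * σ ^ 2) ^ (2 * p) *
      ∫ y : ({h : Fin p // h ≠ j} → ℂ) × (Fin p → ℂ), marginalIntegrand j s z σ y.1 y.2 := by
  have h := integrable_marginalIntegrand hp j s z hσ
  rw [Measure.volume_eq_prod] at h
  rw [marginalDensity, Measure.volume_eq_prod, integral_prod _ h]

theorem marginalDensity_eq_kernelMass (hp : 0 < p) (j : Fin p) (s : Fin (2 * p) → ℂ) (z : ℂ)
    {σ : ℝ} (hσ : 0 < σ) :
    marginalDensity j s z σ = 1 / (Real.pi * σ ^ 2) ^ (2 * p) * (kernelMass j s σ z).toReal := by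
  rw [marginalDensity_eq_integral_prod hp j s z hσ, ← lintegral_marginalIntegrand]
  congr 1
  exact integral_eq_lintegral_of_nonneg_ae
    (Eventually.of_forall fun y => marginalIntegrand_nonneg j s z σ y.1 y.2)
    (continuous_marginalIntegrand j s z σ).aestronglyMeasurable

theorem marginalDensity_nonneg (j : Fin p) (s : Fin (2 * p) → ℂ) (z : ℂ) (σ : ℝ) :
    0 ≤ marginalDensity j s z σ := by
  refine mul_nonneg (by positivity) (integral_nonneg fun ζ => integral_nonneg fun γ => ?_)
  exact marginalIntegrand_nonneg j s z σ ζ γ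

theorem jacNorm_smul (x γ : Fin p → ℂ) {σ : ℝ} (hσ : 0 < σ) :
    jacNorm x (σ • γ) = σ ^ p * jacNorm x γ := by
  simp [jacNorm, Finset.prod_mul_distrib, abs_of_pos hσ, mul_assoc]

theorem samples_smul (x γ : Fin p → ℂ) (σ : ℝ) : samples x (σ • γ) = σ • samples x γ := by
  funext k
  simp [samples, Finset.mul_sum, mul_assoc]

theorem jointKernel_smul (s : Fin (2 * p) → ℂ) (x γ : Fin p → ℂ) {σ : ℝ} (hσ : 0 < σ) :
    jointKernel s σ x (σ • γ) = σ ^ (2 * p) * jointKernel (σ⁻¹ • s) 1 x γ := by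
  rw [jointKernel, jointKernel, jacNorm_smul x γ hσ, samples_smul]
  have h : ∀ k, ‖(σ • samples x γ) k - s k‖ ^ 2 =
      σ ^ 2 * ‖samples x γ k - (σ⁻¹ • s) k‖ ^ 2 := by
    intro k
    have : (σ • samples x γ) k - s k = σ • (samples x γ k - (σ⁻¹ • s) k) := by
      rw [smul_sub, Pi.smul_apply, Pi.smul_apply, smul_inv_smul₀ hσ.ne']
    rw [this, norm_smul, mul_pow, Real.norm_eq_abs, sq_abs]
  simp_rw [h]
  rw [← Finset.mul_sum]
  have h2 : -(1 / σ ^ 2) * (σ ^ 2 * ∑ k, ‖samples x γ k - (σ⁻¹ • s) k‖ ^ 2) =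
      -(1 / 1 ^ 2) * ∑ k, ‖samples x γ k - (σ⁻¹ • s) k‖ ^ 2 := by field_simp
  rw [h2]
  ring

theorem integral_eq_pow_mul_integral_smul (f : (Fin p → ℂ) → ℝ) {σ : ℝ} (hσ : 0 < σ) :
    ∫ γ, f γ = σ ^ (2 * p) * ∫ γ, f (σ • γ) := by
  have hfr : Module.finrank ℝ (Fin p → ℂ) = 2 * p := by
    simp [Module.finrank_pi_fintype, Complex.finrank_real_complex, mul_comm]
  rw [Measure.integral_comp_smul, hfr, abs_of_pos (by positivity), smul_eq_mul, ← mul_assoc,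
    mul_inv_cancel₀ (by positivity), one_mul]

theorem marginalDensity_scale (j : Fin p) (s : Fin (2 * p) → ℂ) (z : ℂ) {σ : ℝ} (hσ : 0 < σ) :
    marginalDensity j s z σ = marginalDensity j (σ⁻¹ • s) z 1 := by
  rw [marginalDensity, marginalDensity]
  simp_rw [marginalIntegrand_eq]
  have h : ∀ ζ : {h : Fin p // h ≠ j} → ℂ, ∫ γ, jointKernel s σ (nodes j ζ z) γ =
      (σ ^ (2 * p) * σ ^ (2 * p)) * ∫ γ, jointKernel (σ⁻¹ • s) 1 (nodes j ζ z) γ := by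
    intro ζ
    rw [integral_eq_pow_mul_integral_smul _ hσ]
    simp_rw [jointKernel_smul _ _ _ hσ]
    rw [integral_const_mul, mul_assoc]
  simp_rw [h]
  rw [integral_const_mul, ← mul_assoc]
  congr 1
  have := Real.pi_pos
  field_simp
  ring

theorem marginalDensity_zero_scale (j : Fin p) (z : ℂ) {σ : ℝ} (hσ : 0 < σ) :
    marginalDensity j 0 z σ = marginalDensity j 0 z 1 := by
  rw [marginalDensity_scale j 0 z hσ, smul_zero]

theorem tendsto_marginalDensity (hp : 0 < p) (j : Fin p) (s : Fin (2 * p) → ℂ) (z : ℂ) :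
    Tendsto (fun σ : ℝ => marginalDensity j s z σ) atTop (𝓝 (marginalDensity j 0 z 1)) := by
  have h1 : (fun σ : ℝ => marginalDensity j s z σ) =ᶠ[atTop]
      fun σ => 1 / (Real.pi * 1 ^ 2) ^ (2 * p) *
        ∫ y : ({h : Fin p // h ≠ j} → ℂ) × (Fin p → ℂ),
          marginalIntegrand j (σ⁻¹ • s) z 1 y.1 y.2 := by
    filter_upwards [eventually_gt_atTop 0] with σ hσ
    rw [marginalDensity_scale j s z hσ, marginalDensity_eq_integral_prod hp _ _ _ one_pos]
  rw [tendsto_congr' h1, marginalDensity_eq_integral_prod hp _ _ _ one_pos]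
  refine Tendsto.const_mul _ ?_
  -- For `σ ≥ 1` the rescaled signal is no larger than `s`, so one bound serves all these `σ`.
  refine tendsto_integral_filter_of_dominated_convergence
    (fun y => Real.exp (∑ k, ‖s k‖ ^ 2) * marginalIntegrand j 0 z (√2 * 1) y.1 y.2) ?_ ?_ ?_ ?_
  · exact Eventually.of_forall fun σ =>
      (continuous_marginalIntegrand j _ z 1).aestronglyMeasurable
  · filter_upwards [eventually_ge_atTop 1] with σ hσ
    refine Eventually.of_forall fun y => ?_
    rw [Real.norm_of_nonneg (marginalIntegrand_nonneg _ _ _ _ _ _)]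
    refine (marginalIntegrand_le j _ z one_pos y.1 y.2).trans ?_
    refine mul_le_mul_of_nonneg_right (Real.exp_le_exp.2 ?_) (marginalIntegrand_nonneg _ _ _ _ _ _)
    rw [one_pow, div_one, one_mul]
    refine Finset.sum_le_sum fun k _ => ?_
    rw [Pi.smul_apply, norm_smul, Real.norm_of_nonneg (by positivity)]
    have : σ⁻¹ ≤ 1 := inv_le_one_of_one_le₀ hσ
    gcongr
    exact mul_le_of_le_one_left (norm_nonneg _) this
  · exact (integrable_marginalIntegrand_zero hp j z (by positivity)).const_mul _
  · refine Eventually.of_forall fun y => ?_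
    have hc : Continuous fun s : Fin (2 * p) → ℂ => marginalIntegrand j s z 1 y.1 y.2 := by
      unfold marginalIntegrand; fun_prop
    have h2 : Tendsto (fun σ : ℝ => σ⁻¹ • s) atTop (𝓝 0) := by
      simpa using (tendsto_inv_atTop_zero (𝕜 := ℝ)).smul_const s
    exact (hc.tendsto 0).comp h2

theorem nodes_comp_swap (j j' : Fin p) (ζ : {h : Fin p // h ≠ j} → ℂ) (z : ℂ)
    (e : {h : Fin p // h ≠ j'} ≃ {h : Fin p // h ≠ j})
    (he : ∀ h, (e h : Fin p) = Equiv.swap j j' h) :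
    nodes j ζ z ∘ Equiv.swap j j' = nodes j' (ζ ∘ e) z := by
  funext h
  by_cases hj : h = j'
  · subst hj
    simp [nodes]
  · have h1 : Equiv.swap j j' h ≠ j := by
      rw [← he ⟨h, hj⟩]
      exact (e ⟨h, hj⟩).2
    simp only [nodes, Function.comp_apply, hj, h1, dite_false]
    congr 1
    exact Subtype.ext (he ⟨h, hj⟩).symm

theorem marginalDensity_index (j j' : Fin p) (s : Fin (2 * p) → ℂ) (z : ℂ) (σ : ℝ) :
    marginalDensity j s z σ = marginalDensity j' s z σ := by
  let e : {h : Fin p // h ≠ j'} ≃ {h : Fin p // h ≠ j} :=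
    (Equiv.swap j j').subtypeEquiv fun h => by
      rw [not_iff_not, Equiv.swap_apply_eq_iff, Equiv.swap_apply_left]
  rw [marginalDensity, marginalDensity]
  congr 1
  simp_rw [marginalIntegrand_eq]
  rw [← integral_comp_equiv e]
  refine integral_congr_ae (Eventually.of_forall fun ζ => ?_)
  dsimp only
  rw [← integral_comp_equiv (Equiv.swap j j')
    fun γ => jointKernel s σ (nodes j' (ζ ∘ e) z) γ]
  refine integral_congr_ae (Eventually.of_forall fun γ => ?_)
  dsimp only
  rw [← nodes_comp_swap j j' ζ z e fun _ => rfl, jointKernel_comp_equiv]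

/-- Rotating the nodes by `a` multiplies sample `k` by the unimodular `a ^ k` and keeps all
distances; without a signal only moduli of samples matter. -/
theorem jointKernel_rotate (a : Circle) (σ : ℝ) (x γ : Fin p → ℂ) :
    jointKernel 0 σ (fun i => a * x i) γ = jointKernel 0 σ x γ := by
  have h1 : ∀ k, ‖samples (fun i => a * x i) γ k‖ = ‖samples x γ k‖ := by
    intro k
    have : samples (fun i => a * x i) γ k = (a : ℂ) ^ (k : ℕ) * samples x γ k := by
      simp only [samples, Finset.mul_sum]
      exact Finset.sum_congr rfl fun h _ => by ring
    rw [this, norm_mul, norm_pow, Circle.norm_coe, one_pow, one_mul]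
  simp only [jointKernel, jacNorm, spread_smul _ (Circle.norm_coe a), Pi.zero_apply, sub_zero, h1]

theorem marginalDensity_rotate (j : Fin p) (a : Circle) (z : ℂ) (σ : ℝ) :
    marginalDensity j 0 (a * z) σ = marginalDensity j 0 z σ := by
  rw [marginalDensity, marginalDensity]
  congr 1
  simp_rw [marginalIntegrand_eq]
  rw [← integral_comp_rotation a]
  refine integral_congr_ae (Eventually.of_forall fun ζ => ?_)
  refine integral_congr_ae (Eventually.of_forall fun γ => ?_)
  rw [← jointKernel_rotate a σ (nodes j ζ z)]
  congr 1
  funext i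
  by_cases h : i = j <;> simp [nodes, h]

theorem marginalDensity_eq_of_norm (j : Fin p) (z : ℂ) (σ : ℝ) :
    marginalDensity j 0 z σ = marginalDensity j 0 (‖z‖ : ℂ) σ := by
  obtain ⟨a, ha⟩ : ∃ a : Circle, (a : ℂ) * ‖z‖ = z :=
    ⟨Circle.exp z.arg, by rw [Circle.coe_exp, mul_comm, Complex.norm_mul_exp_arg_mul_I]⟩
  conv_lhs => rw [← ha]
  exact marginalDensity_rotate j a _ σ

theorem measurable_marginalDensity (hp : 0 < p) (j : Fin p) (s : Fin (2 * p) → ℂ) {σ : ℝ}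
    (hσ : 0 < σ) : Measurable fun z => marginalDensity j s z σ := by
  simp_rw [marginalDensity_eq_kernelMass hp j s _ hσ]
  exact (measurable_kernelMass j s σ).ennreal_toReal.const_mul _

end Marginal

/-! ### Real and complex forms of the Gaussian vector -/

section Stack

variable {p : ℕ}

theorem realIsomorph_mulVec_stackVec (M : Matrix (Fin p) (Fin p) ℂ) (v : Fin p → ℂ) :
    (realIsomorph M).mulVec (stackVec v) = stackVec (M.mulVec v) := by
  funext i
  rcases i with i | i
  · simp [realIsomorph, stackVec, Matrix.mulVec, dotProduct, Complex.mul_re,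
      Finset.sum_sub_distrib]; ring
  · simp [realIsomorph, stackVec, Matrix.mulVec, dotProduct, Complex.mul_im,
      Finset.sum_add_distrib, add_comm]

theorem stackVec_dotProduct (u v : Fin p → ℂ) :
    stackVec u ⬝ᵥ stackVec v = (star u ⬝ᵥ v).re := by
  simp [stackVec, dotProduct, Complex.mul_re, Finset.sum_add_distrib]

theorem stackVec_surjective : Function.Surjective (stackVec (p := p)) := by
  intro g
  refine ⟨fun i => ⟨g (Sum.inl i), g (Sum.inr i)⟩, ?_⟩
  funext i
  rcases i with i | i <;> rfl

theorem stackVec_sub (u v : Fin p → ℂ) : stackVec (u - v) = stackVec u - stackVec v := by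
  funext i
  rcases i with i | i <;> simp [stackVec]

theorem stackVec_eq_zero_iff (v : Fin p → ℂ) : stackVec v = 0 ↔ v = 0 := by
  constructor
  · intro h
    funext i
    exact Complex.ext (congrFun h (Sum.inl i)) (congrFun h (Sum.inr i))
  · rintro rfl
    funext i
    rcases i with i | i <;> simp [stackVec]

theorem stackVec_matA (i : Fin p) (v : Fin p → ℂ) :
    stackVec v ⬝ᵥ (matA i).mulVec (stackVec v) = ‖v i‖ ^ 2 := by
  rw [← Complex.normSq_eq_norm_sq, Complex.normSq_apply]
  simp [matA, stackVec, dotProduct, Matrix.mulVec, Matrix.single_apply, Fintype.sum_sum_type,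
    ite_and]

theorem integral_stackVec (f : (Fin p ⊕ Fin p → ℝ) → ℝ) :
    ∫ g, f g = ∫ v : Fin p → ℂ, f (stackVec v) := by
  have h1 : MeasurePreserving fun (v : Fin p → ℂ) i => Complex.measurableEquivRealProd (v i) :=
    volume_preserving_pi fun _ => Complex.volume_preserving_equiv_real_prod
  have h2 := volume_measurePreserving_arrowProdEquivProdArrow ℝ ℝ (Fin p)
  have h3 := volume_measurePreserving_sumPiEquivProdPi_symm (fun _ : Fin p ⊕ Fin p => ℝ)
  have e1 : MeasurableEmbedding fun (v : Fin p → ℂ) i => Complex.measurableEquivRealProd (v i) :=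
    (MeasurableEquiv.piCongrRight fun _ : Fin p =>
      Complex.measurableEquivRealProd).measurableEmbedding
  rw [← h3.integral_comp (MeasurableEquiv.measurableEmbedding _),
    ← h2.integral_comp (MeasurableEquiv.measurableEmbedding _), ← h1.integral_comp e1]
  refine integral_congr_ae (Eventually.of_forall fun v => ?_)
  dsimp only
  congr 1

end Stack

/-! ### The Gram matrix and its degeneracy -/

section Gram

variable {p : ℕ} (j : Fin p) (ζ : {h : Fin p // h ≠ j} → ℂ) (z : ℂ)

theorem conjTranspose_matX_mulVec (v : Fin p → ℂ) :
    (matX j ζ z).conjTranspose.mulVec v = samples (nodes j ζ z) v := by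
  funext k
  simp [matX, samples, Matrix.mulVec, dotProduct, Matrix.conjTranspose_apply, mul_comm]

/-- `Q = X Xᴴ`, and `Xᴴ v` is the vector of samples with weights `v`; this links the Gaussian of
`f_j` to the exponent of the kernel. -/
theorem quadraticForm_matQ (v : Fin p → ℂ) :
    stackVec v ⬝ᵥ (realIsomorph (matQ j ζ z)).mulVec (stackVec v) =
      ∑ k, ‖samples (nodes j ζ z) v k‖ ^ 2 := by
  rw [realIsomorph_mulVec_stackVec, stackVec_dotProduct, matQ, ← Matrix.mulVec_mulVec,
    Matrix.dotProduct_mulVec, ← conjTranspose_matX_mulVec]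
  have h : Matrix.vecMul (star v) (matX j ζ z) =
      star ((matX j ζ z).conjTranspose.mulVec v) := by
    rw [Matrix.star_mulVec, Matrix.conjTranspose_conjTranspose]
  rw [h]
  simp only [dotProduct, Pi.star_apply, Complex.re_sum]
  refine Finset.sum_congr rfl fun k _ => ?_
  rw [Complex.star_def, ← Complex.normSq_eq_conj_mul_self, Complex.ofReal_re,
    Complex.normSq_eq_norm_sq]

theorem detD_nonneg : 0 ≤ detD j ζ z := by
  refine Matrix.PosSemidef.det_nonneg (Matrix.PosSemidef.of_dotProduct_mulVec_nonneg ?_ ?_)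
  · have h : (matQ j ζ z).IsHermitian := Matrix.isHermitian_mul_conjTranspose_self _
    have hr : ∀ a b, (matQ j ζ z b a).re = (matQ j ζ z a b).re := fun a b => by
      rw [← h.apply a b]; simp
    have hi : ∀ a b, (matQ j ζ z b a).im = -(matQ j ζ z a b).im := fun a b => by
      rw [← h.apply a b]; simp
    ext a b
    rcases a with a | a <;> rcases b with b | b <;>
      simp [realIsomorph, Matrix.conjTranspose_apply, hr a b, hi a b]
  · intro g
    obtain ⟨v, rfl⟩ := stackVec_surjective g
    rw [star_trivial, quadraticForm_matQ]
    positivity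

variable {j ζ z}

theorem eq_zero_of_samples_eq_zero (hD : detD j ζ z ≠ 0) {v : Fin p → ℂ}
    (hv : samples (nodes j ζ z) v = 0) : v = 0 := by
  by_contra hne
  refine hD (Matrix.exists_mulVec_eq_zero_iff.1 ⟨stackVec v, ?_, ?_⟩)
  · rwa [Ne, stackVec_eq_zero_iff]
  · rw [realIsomorph_mulVec_stackVec, stackVec_eq_zero_iff, matQ, ← Matrix.mulVec_mulVec,
      conjTranspose_matX_mulVec, hv, Matrix.mulVec_zero]

/-- Distinct nodes make the samples injective in the weights, hence `Q` nonsingular. So where `D_j =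
0` the Jacobian vanishes too, and the undefined `β` is harmless. -/
theorem spread_eq_zero_of_detD (hD : detD j ζ z = 0) : spread (nodes j ζ z) = 0 := by
  obtain ⟨g, hg, h0⟩ := Matrix.exists_mulVec_eq_zero_iff.2 hD
  obtain ⟨v, rfl⟩ := stackVec_surjective g
  have h1 := quadraticForm_matQ j ζ z v
  rw [h0, dotProduct_zero, eq_comm, Finset.sum_eq_zero_iff_of_nonneg fun _ _ => by positivity] at h1
  have h2 : samples (nodes j ζ z) v = samples (nodes j ζ z) 0 := by
    funext k
    have := h1 k (Finset.mem_univ k)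
    rw [sq_eq_zero_iff, norm_eq_zero] at this
    rw [this]
    simp [samples]
  rw [spread_eq_zero_iff]
  intro hinj
  exact hg ((stackVec_eq_zero_iff v).2 (samples_right_injective hinj h2))

theorem exists_pos_mul_le_sum_samples {x : Fin p → ℂ} (hx : ∀ v, samples x v = 0 → v = 0) :
    ∃ c > 0, ∀ v, c * ∑ i, ‖v i‖ ^ 2 ≤ ∑ k, ‖samples x v k‖ ^ 2 := by
  let L : (Fin p → ℂ) →ₗ[ℂ] (Fin (2 * p) → ℂ) :=
    { toFun := samples x
      map_add' := fun u v => by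
        funext k; simp [samples, add_mul, Finset.sum_add_distrib]
      map_smul' := fun a v => by
        funext k; simp [samples, Finset.mul_sum, mul_assoc] }
  obtain ⟨K, hK, hL⟩ := L.exists_antilipschitzWith (LinearMap.ker_eq_bot'.2 hx)
  have hK' : (0 : ℝ) < K := hK
  refine ⟨(p * K ^ 2 + 1 : ℝ)⁻¹, by positivity, fun v => ?_⟩
  set S := ∑ k, ‖samples x v k‖ ^ 2 with hS
  have hS0 : 0 ≤ S := by positivity
  have h1 : ‖v‖ ≤ K * ‖samples x v‖ := by
    have := hL.le_mul_dist v 0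
    rwa [map_zero, dist_zero_right, dist_zero_right] at this
  have h2 : ‖samples x v‖ ≤ √S := by
    refine (pi_norm_le_iff_of_nonneg (Real.sqrt_nonneg _)).2 fun k => Real.le_sqrt_of_sq_le ?_
    exact Finset.single_le_sum (f := fun k => ‖samples x v k‖ ^ 2) (fun _ _ => by positivity)
      (Finset.mem_univ k)
  have h3 : ∀ i, ‖v i‖ ^ 2 ≤ K ^ 2 * S := by
    intro i
    have h4 : ‖v i‖ ≤ K * √S := (norm_le_pi_norm v i).trans (h1.trans (by gcongr))
    calc ‖v i‖ ^ 2 ≤ (K * √S) ^ 2 := by gcongr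
      _ = K ^ 2 * S := by rw [mul_pow, Real.sq_sqrt hS0]
  have h5 : ∑ i, ‖v i‖ ^ 2 ≤ p * (K ^ 2 * S) := by
    calc _ ≤ ∑ _i : Fin p, (K ^ 2 * S : ℝ) := Finset.sum_le_sum fun i _ => h3 i
      _ = _ := by simp
  rw [inv_mul_le_iff₀ (by positivity)]
  nlinarith

end Gram

/-! ### Gaussian moments as even polynomials -/

section ShiftedMoment

variable {p : ℕ}

/-- Half of the exponent is spent on bounding the quadratic factor; the other half remains
integrable. -/
theorem integrable_norm_sq_mul_exp {c : ℝ} (hc : 0 < c) (m : ℂ) (t : ℝ) :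
    Integrable fun w : ℂ => ‖m + t * w‖ ^ 2 * Real.exp (-c * ‖w‖ ^ 2) := by
  refine ((integrable_exp_neg_mul_norm_sq (half_pos hc)).const_mul
    (2 * ‖m‖ ^ 2 + 4 * t ^ 2 / c)).mono'
    (Continuous.aestronglyMeasurable (by fun_prop)) (Eventually.of_forall fun w => ?_)
  rw [Real.norm_of_nonneg (by positivity)]
  have h1 : Real.exp (-c * ‖w‖ ^ 2) =
      Real.exp (-(c / 2) * ‖w‖ ^ 2) * Real.exp (-(c / 2) * ‖w‖ ^ 2) := by
    rw [← Real.exp_add]; congr 1; ring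
  have h2 : ‖m + t * w‖ ≤ ‖m‖ + |t| * ‖w‖ := by
    refine (norm_add_le _ _).trans ?_
    rw [norm_mul, Complex.norm_real, Real.norm_eq_abs]
  have h3 : ‖m + t * w‖ ^ 2 ≤ 2 * ‖m‖ ^ 2 + 2 * (t ^ 2 * ‖w‖ ^ 2) := by
    calc ‖m + t * w‖ ^ 2 ≤ (‖m‖ + |t| * ‖w‖) ^ 2 := by gcongr
      _ ≤ 2 * ‖m‖ ^ 2 + 2 * (|t| * ‖w‖) ^ 2 := by nlinarith [sq_nonneg (‖m‖ - |t| * ‖w‖)]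
      _ = _ := by rw [mul_pow, sq_abs]
  set E := Real.exp (-(c / 2) * ‖w‖ ^ 2) with hE
  have hE0 : 0 < E := Real.exp_pos _
  have hE1 : E ≤ 1 := Real.exp_le_one_iff.2 (by nlinarith [sq_nonneg ‖w‖])
  have h4 : (c / 2 * ‖w‖ ^ 2) * E ≤ 1 := by
    have h5 := Real.add_one_le_exp (c / 2 * ‖w‖ ^ 2)
    have h6 : Real.exp (c / 2 * ‖w‖ ^ 2) * E = 1 := by
      rw [hE, ← Real.exp_add, neg_mul, add_neg_cancel, Real.exp_zero]
    nlinarith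
  have h7 : ‖w‖ ^ 2 * E ≤ 2 / c := by
    rw [le_div_iff₀ hc]; nlinarith
  rw [h1]
  calc ‖m + t * w‖ ^ 2 * (E * E) ≤ (2 * ‖m‖ ^ 2 + 2 * (t ^ 2 * ‖w‖ ^ 2)) * (E * E) := by gcongr
    _ = (2 * ‖m‖ ^ 2 * E + 2 * t ^ 2 * (‖w‖ ^ 2 * E)) * E := by ring
    _ ≤ (2 * ‖m‖ ^ 2 * 1 + 2 * t ^ 2 * (2 / c)) * E := by gcongr
    _ = _ := by ring

theorem integrable_shifted {x : Fin p → ℂ} (hx : ∀ v, samples x v = 0 → v = 0)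
    (μ : Fin p → ℂ) (t : ℝ) :
    Integrable fun y : Fin p → ℂ =>
      (∏ i, ‖μ i + t * y i‖ ^ 2) * Real.exp (-∑ k, ‖samples x y k‖ ^ 2) := by
  obtain ⟨c, hc, hle⟩ := exists_pos_mul_le_sum_samples hx
  have h1 := Integrable.fintype_prod (ι := Fin p) (μ := fun _ => (volume : Measure ℂ))
    fun i => integrable_norm_sq_mul_exp hc (μ i) t
  refine h1.mono' (Continuous.aestronglyMeasurable (by unfold samples; fun_prop))
    (Eventually.of_forall fun y => ?_)
  rw [Real.norm_of_nonneg (by positivity), Finset.prod_mul_distrib, ← Real.exp_sum,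
    ← Finset.mul_sum]
  refine mul_le_mul_of_nonneg_left (Real.exp_le_exp.2 ?_) (by positivity)
  linarith [hle y]

/-- `∫ ∏_i |μ_i + t y_i|² exp (-‖samples x y‖²) dy`. -/
noncomputable def shiftedMoment (x μ : Fin p → ℂ) (t : ℝ) : ℝ :=
  ∫ y : Fin p → ℂ, (∏ i, ‖μ i + t * y i‖ ^ 2) * Real.exp (-∑ k, ‖samples x y k‖ ^ 2)

theorem shiftedMoment_neg (x μ : Fin p → ℂ) (t : ℝ) :
    shiftedMoment x μ (-t) = shiftedMoment x μ t := by
  rw [shiftedMoment, ← integral_neg_eq_self, shiftedMoment]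
  refine integral_congr_ae (Eventually.of_forall fun y => ?_)
  have : samples x (-y) = -samples x y := by
    funext k; simp [samples]
  simp [this]

theorem sum_even_part (a : ℕ → ℝ) (t : ℝ) (p : ℕ) :
    ∑ k ∈ Finset.range (2 * p + 1), a k * ((t ^ k + (-t) ^ k) / 2) =
      ∑ h ∈ Finset.range (p + 1), a (2 * h) * t ^ (2 * h) := by
  induction p with
  | zero => simp
  | succ p ih =>
    rw [show 2 * (p + 1) + 1 = 2 * p + 1 + 1 + 1 by ring, Finset.sum_range_succ,
      Finset.sum_range_succ, ih, Finset.sum_range_succ _ (p + 1), add_assoc]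
    congr 1
    have h1 : (-t) ^ (2 * p + 1) = -t ^ (2 * p + 1) := Odd.neg_pow ⟨p, rfl⟩ t
    have h2 : (-t) ^ (2 * p + 1 + 1) = t ^ (2 * p + 1 + 1) := Even.neg_pow ⟨p + 1, by ring⟩ t
    rw [h1, h2, show 2 * (p + 1) = 2 * p + 1 + 1 by ring]
    ring

/-- `∏_i |μ_i + t y_i|²` as a polynomial in `t`. -/
noncomputable def shiftPolynomial (μ y : Fin p → ℂ) : Polynomial ℝ :=
  ∏ i, (Polynomial.C (‖y i‖ ^ 2) * Polynomial.X ^ 2 +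
    Polynomial.C (2 * (μ i * star (y i)).re) * Polynomial.X + Polynomial.C (‖μ i‖ ^ 2))

theorem eval_shiftPolynomial (μ y : Fin p → ℂ) (t : ℝ) :
    (shiftPolynomial μ y).eval t = ∏ i, ‖μ i + t * y i‖ ^ 2 := by
  rw [shiftPolynomial, Polynomial.eval_prod]
  refine Finset.prod_congr rfl fun i _ => ?_
  simp only [← Complex.normSq_eq_norm_sq, Complex.normSq_apply]
  simp
  ring

theorem natDegree_shiftPolynomial_le (μ y : Fin p → ℂ) :
    (shiftPolynomial μ y).natDegree ≤ 2 * p := by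
  refine (Polynomial.natDegree_prod_le _ _).trans ?_
  refine (Finset.sum_le_card_nsmul _ _ 2 fun i _ => Polynomial.natDegree_quadratic_le).trans ?_
  simp [mul_comm]

theorem coeff_shiftPolynomial (μ y : Fin p → ℂ) :
    (shiftPolynomial μ y).coeff (2 * p) = ∏ i, ‖y i‖ ^ 2 := by
  have h := Polynomial.coeff_prod_of_natDegree_le (s := Finset.univ)
    (f := fun i => Polynomial.C (‖y i‖ ^ 2) * Polynomial.X ^ 2 +
      Polynomial.C (2 * (μ i * star (y i)).re) * Polynomial.X + Polynomial.C (‖μ i‖ ^ 2))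
    2 fun i _ => Polynomial.natDegree_quadratic_le
  rw [Finset.card_univ, Fintype.card_fin, mul_comm] at h
  rw [shiftPolynomial, h]
  refine Finset.prod_congr rfl fun i _ => ?_
  have hc : ∀ a b c : ℝ, (Polynomial.C a * Polynomial.X ^ 2 + Polynomial.C b * Polynomial.X +
      Polynomial.C c).coeff 2 = a := fun a b c => by
    simp
  exact hc _ _ _

/-- The integrand is a polynomial of degree at most `2p` in `t`, and `y ↦ -y` makes its integral
even. The `t ^ (2p)` coefficient of the integrand contains only `y`, so `μ`, and with it the signal,
drops out of the top coefficient. -/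
theorem exists_shiftedMoment_eq {x : Fin p → ℂ} (hx : ∀ v, samples x v = 0 → v = 0)
    (μ : Fin p → ℂ) :
    ∃ a : ℕ → ℝ, (∀ t, shiftedMoment x μ t = ∑ h ∈ Finset.range (p + 1), a h * t ^ (2 * h)) ∧
      a p = shiftedMoment x 0 1 := by
  set v : Fin (2 * p + 1) → ℝ := fun i => ((i : ℕ) : ℝ) with hv
  have hvinj : Set.InjOn v (Finset.univ : Finset (Fin (2 * p + 1))) := by
    intro i _ k _ h
    exact Fin.ext (Nat.cast_injective (R := ℝ) h)
  set P : Polynomial ℝ := Lagrange.interpolate Finset.univ v fun i => shiftedMoment x μ (v i)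
    with hP
  have hint : ∀ y, shiftPolynomial μ y = ∑ i, Polynomial.C ((shiftPolynomial μ y).eval (v i)) *
      Lagrange.basis Finset.univ v i := by
    intro y
    rw [← Lagrange.interpolate_apply]
    refine Lagrange.eq_interpolate hvinj ?_
    rw [Finset.card_univ, Fintype.card_fin]
    refine (Polynomial.degree_le_natDegree).trans_lt ?_
    exact_mod_cast Nat.lt_succ_of_le (natDegree_shiftPolynomial_le μ y)
  -- Interpolation at `2p + 1` points writes the random polynomial as a finite combination of fixed
  -- ones, with coefficients known to be integrable. Hence every linear functional commutes with the
  -- integral; evaluation and top coefficient are the two needed.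
  have key : ∀ ℓ : Polynomial ℝ →ₗ[ℝ] ℝ,
      ∫ y : Fin p → ℂ, ℓ (shiftPolynomial μ y) * Real.exp (-∑ k, ‖samples x y k‖ ^ 2) = ℓ P := by
    intro ℓ
    have h1 : ∀ y : Fin p → ℂ,
        ℓ (shiftPolynomial μ y) * Real.exp (-∑ k, ‖samples x y k‖ ^ 2) =
        ∑ i, (ℓ (Lagrange.basis Finset.univ v i)) * ((∏ h, ‖μ h + v i * y h‖ ^ 2) *
          Real.exp (-∑ k, ‖samples x y k‖ ^ 2)) := by
      intro y
      conv_lhs => rw [hint y]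
      rw [map_sum, Finset.sum_mul]
      refine Finset.sum_congr rfl fun i _ => ?_
      rw [← Polynomial.smul_eq_C_mul, map_smul, smul_eq_mul, eval_shiftPolynomial]
      ring
    simp_rw [h1]
    rw [integral_finsetSum _ fun i _ => (integrable_shifted hx μ (v i)).const_mul _, hP,
      Lagrange.interpolate_apply, map_sum]
    refine Finset.sum_congr rfl fun i _ => ?_
    rw [integral_const_mul, ← Polynomial.smul_eq_C_mul, map_smul, smul_eq_mul, mul_comm]
    rfl
  have heval : ∀ t, shiftedMoment x μ t = P.eval t := by
    intro t
    have h := key (Polynomial.leval t)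
    simp only [Polynomial.leval_apply, eval_shiftPolynomial] at h
    exact h
  have hcoeff : P.coeff (2 * p) = shiftedMoment x 0 1 := by
    have h := key (Polynomial.lcoeff ℝ (2 * p))
    simp only [Polynomial.lcoeff_apply, coeff_shiftPolynomial] at h
    rw [← h, shiftedMoment]
    simp
  have hdeg : P.natDegree < 2 * p + 1 := by
    by_cases h0 : P = 0
    · rw [h0]; simp
    · rw [Polynomial.natDegree_lt_iff_degree_lt h0]
      have := Lagrange.degree_interpolate_lt (r := fun i => shiftedMoment x μ (v i)) hvinj
      rwa [Finset.card_univ, Fintype.card_fin] at this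
  refine ⟨fun h => P.coeff (2 * h), fun t => ?_, hcoeff⟩
  have h1 : shiftedMoment x μ t = (P.eval t + P.eval (-t)) / 2 := by
    rw [← heval, ← heval, shiftedMoment_neg]; ring
  rw [h1, Polynomial.eval_eq_sum_range' hdeg, Polynomial.eval_eq_sum_range' hdeg,
    ← sum_even_part P.coeff, ← Finset.sum_add_distrib, Finset.sum_div]
  exact Finset.sum_congr rfl fun k _ => by ring

end ShiftedMoment

/-! ### The coefficients `β_h` and the limit density -/

section MomentExpansion

variable {p : ℕ} {j : Fin p} {ζ : {h : Fin p // h ≠ j} → ℂ} {z : ℂ}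

/-- Substitute `g = μ + σ y`: the volume factor `σ ^ (2p)` cancels the one in the Gaussian
normalization. -/
theorem quadMoment_eq (s : Fin (2 * p) → ℂ) {σ : ℝ} (hσ : 0 < σ) :
    quadMoment j s ζ z σ = √(detD j ζ z) / Real.pi ^ p *
      shiftedMoment (nodes j ζ z) (vecMu j s ζ z) σ := by
  have hdet : √((realIsomorph (matQ j ζ z))⁻¹.det) = (√(detD j ζ z))⁻¹ := by
    rw [Matrix.det_nonsing_inv, Ring.inverse_eq_inv', Real.sqrt_inv]
    rfl
  rw [quadMoment, hdet, integral_stackVec]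
  set μ := vecMu j s ζ z with hμ
  simp_rw [stackVec_matA, ← stackVec_sub, quadraticForm_matQ]
  rw [← integral_add_right_eq_self _ μ, integral_eq_pow_mul_integral_smul _ hσ]
  have h : ∀ y : Fin p → ℂ, (∏ i, ‖(σ • y + μ) i‖ ^ 2) *
      Real.exp (-(1 / σ ^ 2) * ∑ k, ‖samples (nodes j ζ z) (σ • y + μ - μ) k‖ ^ 2) =
      (∏ i, ‖μ i + σ * y i‖ ^ 2) * Real.exp (-∑ k, ‖samples (nodes j ζ z) y k‖ ^ 2) := by
    intro y
    have h1 : ∀ i, (σ • y + μ) i = μ i + σ * y i := fun i => by simp [add_comm]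
    have h2 : -(1 / σ ^ 2) * ∑ k, ‖samples (nodes j ζ z) (σ • y + μ - μ) k‖ ^ 2 =
        -∑ k, ‖samples (nodes j ζ z) y k‖ ^ 2 := by
      rw [add_sub_cancel_right, samples_smul]
      simp only [Pi.smul_apply, norm_smul, mul_pow, Real.norm_eq_abs, sq_abs]
      rw [← Finset.mul_sum]
      field_simp
    simp_rw [h1, h2]
  simp_rw [h]
  rw [shiftedMoment]
  have hpi := Real.pi_pos
  rw [← mul_assoc]
  congr 1
  rw [mul_pow, ← pow_mul]
  rcases eq_or_ne (√(detD j ζ z)) 0 with h0 | h0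
  · rw [h0]; simp
  · field_simp

/-- The difference of two expansions is a polynomial in `r = σ²` vanishing on the positive
half-line. -/
theorem IsMomentExpansion.unique {s : Fin (2 * p) → ℂ} (hD : detD j ζ z ≠ 0)
    {b b' : Fin (p + 1) → ℝ} (hb : IsMomentExpansion j s ζ z b)
    (hb' : IsMomentExpansion j s ζ z b') : b = b' := by
  set c : Fin (p + 1) → ℝ := fun h =>
    (b h - b' h) / (2 ^ (h : ℕ) * detD j ζ z ^ (2 * p - (h : ℕ))) with hc
  set Q : Polynomial ℝ := ∑ h : Fin (p + 1), Polynomial.C (c h) * Polynomial.X ^ (h : ℕ) with hQ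
  have hroot : ∀ r : ℝ, 0 < r → Q.IsRoot r := by
    intro r hr
    have h1 := (hb (√r) (Real.sqrt_pos.2 hr)).symm.trans (hb' (√r) (Real.sqrt_pos.2 hr))
    rw [← sub_eq_zero, ← Finset.sum_sub_distrib] at h1
    rw [Polynomial.IsRoot, hQ, Polynomial.eval_finsetSum, ← h1]
    refine Finset.sum_congr rfl fun h _ => ?_
    rw [pow_mul, Real.sq_sqrt hr.le]
    simp only [hc, Polynomial.eval_mul, Polynomial.eval_C, Polynomial.eval_pow, Polynomial.eval_X]
    ring
  have hQ0 : Q = 0 := Polynomial.eq_zero_of_infinite_isRoot Q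
    ((Set.Ioi_infinite (0 : ℝ)).mono fun r hr => hroot r hr)
  funext h
  have hcoeff : Q.coeff h = c h := by
    simp [hQ, Polynomial.coeff_X_pow, Fin.val_inj]
  rw [hQ0, Polynomial.coeff_zero] at hcoeff
  have hne : (2 : ℝ) ^ (h : ℕ) * detD j ζ z ^ (2 * p - (h : ℕ)) ≠ 0 := by positivity
  have := (div_eq_zero_iff.1 hcoeff.symm).resolve_right hne
  linarith

theorem exists_isMomentExpansion (s : Fin (2 * p) → ℂ) (hD : detD j ζ z ≠ 0) :
    ∃ b, IsMomentExpansion j s ζ z b ∧ b (Fin.last p) = √(detD j ζ z) / Real.pi ^ p *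
      shiftedMoment (nodes j ζ z) 0 1 * (2 ^ p * detD j ζ z ^ p) := by
  obtain ⟨a, ha, hap⟩ := exists_shiftedMoment_eq
    (fun v hv => eq_zero_of_samples_eq_zero hD hv) (vecMu j s ζ z)
  refine ⟨fun h => √(detD j ζ z) / Real.pi ^ p * a h *
    (2 ^ (h : ℕ) * detD j ζ z ^ (2 * p - (h : ℕ))), fun σ hσ => ?_, ?_⟩
  · rw [quadMoment_eq s hσ, ha, Finset.mul_sum, ← Fin.sum_univ_eq_sum_range
      (fun h => √(detD j ζ z) / Real.pi ^ p * (a h * σ ^ (2 * h))) (p + 1)]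
    refine Finset.sum_congr rfl fun h _ => ?_
    have hne : (2 : ℝ) ^ (h : ℕ) * detD j ζ z ^ (2 * p - (h : ℕ)) ≠ 0 := by positivity
    field_simp
  · simp only [Fin.val_last, hap]
    rw [show 2 * p - p = p by omega]

theorem isMomentExpansion_coeffBeta (s : Fin (2 * p) → ℂ) (hD : detD j ζ z ≠ 0) :
    IsMomentExpansion j s ζ z (coeffBeta j s ζ z) := by
  have h : ∃ b, IsMomentExpansion j s ζ z b := (exists_isMomentExpansion s hD).imp fun _ h => h.1
  rw [coeffBeta, dif_pos h]
  exact h.choose_spec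

theorem isMomentExpansion_iff (s : Fin (2 * p) → ℂ) (hD : detD j ζ z ≠ 0)
    (b : Fin (p + 1) → ℝ) : IsMomentExpansion j s ζ z b ↔ b = coeffBeta j s ζ z :=
  ⟨fun hb => hb.unique hD (isMomentExpansion_coeffBeta s hD),
    fun hb => hb ▸ isMomentExpansion_coeffBeta s hD⟩

theorem coeffBeta_last (s : Fin (2 * p) → ℂ) (hD : detD j ζ z ≠ 0) :
    coeffBeta j s ζ z (Fin.last p) = √(detD j ζ z) / Real.pi ^ p *
      shiftedMoment (nodes j ζ z) 0 1 * (2 ^ p * detD j ζ z ^ p) := by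
  obtain ⟨b, hb, hbp⟩ := exists_isMomentExpansion s hD
  rw [← (isMomentExpansion_iff s hD b).1 hb, hbp]

theorem integral_jointKernel_zero (x : Fin p → ℂ) :
    ∫ γ, jointKernel 0 1 x γ = spread x ^ 4 * shiftedMoment x 0 1 := by
  rw [shiftedMoment, ← integral_const_mul]
  refine integral_congr_ae (Eventually.of_forall fun γ => ?_)
  simp only [jointKernel, jacNorm, Pi.zero_apply, sub_zero, zero_add, Complex.ofReal_one, one_mul,
    one_pow, div_one, neg_one_mul, Finset.prod_pow]
  ring

/-- The top coefficient carries `D_j ^ p √D_j`, exactly the denominator `D_j ^ ((n+1)/2)`; what is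
left is the noise-only integral over the weights. This also yields independence of `s` and
integrability. -/
theorem limitIntegrand_eq (j : Fin p) (s : Fin (2 * p) → ℂ) (z : ℂ)
    (ζ : {h : Fin p // h ≠ j} → ℂ) :
    limitIntegrand j s z ζ = (2 / Real.pi) ^ p * ∫ γ, marginalIntegrand j 0 z 1 ζ γ := by
  simp_rw [marginalIntegrand_eq]
  rw [integral_jointKernel_zero, limitIntegrand]
  have h8 : (∏ q : {h : Fin p // h ≠ j} × {h : Fin p // h ≠ j} with q.1 < q.2,
      ‖ζ q.1 - ζ q.2‖ ^ 8) * ∏ r, ‖ζ r - z‖ ^ 8 = spread (nodes j ζ z) ^ 4 := by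
    have h := congrArg (· ^ 2) (prod_norm_eq_spread j ζ z)
    simp only [mul_pow, ← Finset.prod_pow, ← pow_mul] at h
    exact h
  rw [h8]
  -- For `D_j = 0` both sides vanish with the spread.
  rcases eq_or_ne (detD j ζ z) 0 with hD | hD
  · rw [spread_eq_zero_of_detD hD]; simp
  · have hpos : 0 < detD j ζ z := lt_of_le_of_ne (detD_nonneg j ζ z) hD.symm
    have hpow : detD j ζ z ^ ((((2 * p : ℕ) : ℝ) + 1) / 2) =
        detD j ζ z ^ p * √(detD j ζ z) := by
      rw [Real.sqrt_eq_rpow, ← Real.rpow_natCast, ← Real.rpow_add hpos]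
      congr 1
      push_cast
      ring
    have hs : 0 < √(detD j ζ z) := Real.sqrt_pos.2 hpos
    have hpi := Real.pi_pos
    rw [coeffBeta_last s hD, hpow, div_pow]
    field_simp

theorem integrable_limitIntegrand (hp : 0 < p) (j : Fin p) (s : Fin (2 * p) → ℂ) (z : ℂ) :
    Integrable (limitIntegrand j s z) := by
  have h := integrable_marginalIntegrand_zero hp j z one_pos
  rw [Measure.volume_eq_prod] at h
  exact (h.integral_prod_left.const_mul _).congr
    (Eventually.of_forall fun ζ => (limitIntegrand_eq j s z ζ).symm)

theorem limitDensity_eq (j : Fin p) (s : Fin (2 * p) → ℂ) (z : ℂ) :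
    limitDensity j s z = marginalDensity j 0 z 1 := by
  rw [limitDensity, marginalDensity]
  simp_rw [limitIntegrand_eq]
  rw [integral_const_mul, ← mul_assoc]
  congr 1
  have hpi := Real.pi_pos
  rw [div_pow, mul_pow, one_pow, mul_one]
  field_simp
  ring

end MomentExpansion

/-! ### Pure noise and the condensed density -/

section Noise

theorem expSignal_eq_zero_iff {p q : ℕ} (hq : q ≤ p) (c ξ : Fin q → ℂ)
    (hξ : Function.Injective ξ) : expSignal p c ξ = 0 ↔ c = 0 := by
  constructor
  · intro h
    refine Matrix.eq_zero_of_forall_pow_sum_mul_pow_eq_zero hξ fun i => ?_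
    exact congrFun h ⟨i, by omega⟩
  · rintro rfl
    funext k
    simp [expSignal]

/-- The density of `complexGaussian σ`. -/
noncomputable def complexGaussianDensity (σ : ℝ) (w : ℂ) : ℝ :=
  1 / (Real.pi * σ ^ 2) * Real.exp (-(1 / σ ^ 2) * ‖w‖ ^ 2)

theorem complexGaussianDensity_nonneg (σ : ℝ) (w : ℂ) : 0 ≤ complexGaussianDensity σ w := by
  have := Real.pi_pos
  unfold complexGaussianDensity; positivity

theorem integrable_complexGaussianDensity {σ : ℝ} (hσ : 0 < σ) :
    Integrable (complexGaussianDensity σ) :=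
  (integrable_exp_neg_mul_norm_sq (by positivity)).const_mul _

/-- Checked on boxes, where the integral of the product density factorizes. Only finiteness of the
Gaussian measure is needed, not its total mass. -/
theorem pi_complexGaussian {ι : Type*} [Fintype ι] {σ : ℝ} (hσ : 0 < σ) :
    Measure.pi (fun _ : ι => complexGaussian σ) =
      volume.withDensity fun d : ι → ℂ => ENNReal.ofReal (∏ k, complexGaussianDensity σ (d k)) := by
  have hint := integrable_complexGaussianDensity hσ
  have hfin : IsFiniteMeasure (complexGaussian σ) :=
    isFiniteMeasure_withDensity_ofReal hint.hasFiniteIntegral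
  refine Measure.pi_eq fun A hA => ?_
  have hA' := MeasurableSet.univ_pi hA
  have h1 : ∀ d : ι → ℂ, (Set.univ.pi A).indicator
      (fun d => ENNReal.ofReal (∏ k, complexGaussianDensity σ (d k))) d =
      ENNReal.ofReal (∏ k, (A k).indicator (complexGaussianDensity σ) (d k)) := by
    intro d
    by_cases hd : d ∈ Set.univ.pi A
    · rw [Set.indicator_of_mem hd]
      congr 1
      exact Finset.prod_congr rfl fun k _ => (Set.indicator_of_mem (hd k trivial) _).symm
    · rw [Set.indicator_of_notMem hd]
      simp only [Set.mem_pi, Set.mem_univ, forall_true_left, not_forall] at hd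
      obtain ⟨k, hk⟩ := hd
      rw [Finset.prod_eq_zero (Finset.mem_univ k) (Set.indicator_of_notMem hk _),
        ENNReal.ofReal_zero]
  have hind : ∀ k, Integrable ((A k).indicator (complexGaussianDensity σ)) :=
    fun k => hint.indicator (hA k)
  have hnn : ∀ k w, 0 ≤ (A k).indicator (complexGaussianDensity σ) w :=
    fun k w => Set.indicator_nonneg (fun _ _ => complexGaussianDensity_nonneg σ _) w
  rw [withDensity_apply _ hA', ← lintegral_indicator hA']
  simp_rw [h1]
  have hprod : Integrable fun d : ι → ℂ =>
      ∏ k, (A k).indicator (complexGaussianDensity σ) (d k) := Integrable.fintype_prod hind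
  rw [← ofReal_integral_eq_lintegral_ofReal hprod
    (Eventually.of_forall fun d => Finset.prod_nonneg fun k _ => hnn k _),
    integral_fintype_prod_volume_eq_prod, ENNReal.ofReal_prod_of_nonneg
      fun k _ => integral_nonneg (hnn k)]
  refine Finset.prod_congr rfl fun k _ => ?_
  rw [ofReal_integral_eq_lintegral_ofReal (hind k) (Eventually.of_forall (hnn k)),
    complexGaussian, withDensity_apply _ (hA k), ← lintegral_indicator (hA k)]
  refine lintegral_congr fun w => ?_
  by_cases hw : w ∈ A k
  · rw [Set.indicator_of_mem hw, Set.indicator_of_mem hw]; rfl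
  · rw [Set.indicator_of_notMem hw, Set.indicator_of_notMem hw, ENNReal.ofReal_zero]

/-- After normalization each of the `p` marginals in the expected count equals the same function.
Their number cancels against the averaging factor `1/p`, leaving the `1/p!` of the unordered
labelling. -/
theorem isCondensedDensity_noise {Ω : Type*} [MeasurableSpace Ω] (P : Measure Ω)
    [IsProbabilityMeasure P] {p : ℕ} (hp : 0 < p) (j : Fin p) {σ : ℝ} (hσ : 0 < σ)
    (ε : Fin (2 * p) → Ω → ℂ) (hε : ∀ k, AEMeasurable (ε k) P) (hindep : iIndepFun ε P)
    (hlaw : ∀ k, P.map (ε k) = complexGaussian σ) :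
    IsCondensedDensity P (fun ω k => ε k ω)
      fun z => marginalDensity j 0 z 1 / (Nat.factorial p : ℝ) := by
  have hpi := Real.pi_pos
  refine ⟨(measurable_marginalDensity hp j 0 one_pos).div_const _,
    fun z => div_nonneg (marginalDensity_nonneg _ _ _ _) (by positivity), fun A hA => ?_⟩
  have hmap : P.map (fun ω k => ε k ω) =
      volume.withDensity fun d : Fin (2 * p) → ℂ =>
        ENNReal.ofReal (∏ k, complexGaussianDensity σ (d k)) := by
    rw [(iIndepFun_iff_map_fun_eq_pi_map hε).1 hindep]
    simp_rw [hlaw]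
    exact pi_complexGaussian hσ
  set κ : ℝ := 1 / (Real.pi * σ ^ 2) ^ (2 * p) with hκ
  have hκ0 : 0 < κ := by positivity
  have hdens : ∀ d : Fin (2 * p) → ℂ, ENNReal.ofReal (∏ k, complexGaussianDensity σ (d k)) =
      ENNReal.ofReal κ * ENNReal.ofReal (Real.exp (-(1 / σ ^ 2) * ∑ k, ‖d k‖ ^ 2)) := by
    intro d
    rw [← ENNReal.ofReal_mul hκ0.le]
    simp only [complexGaussianDensity]
    rw [Finset.prod_mul_distrib, Finset.prod_const, Finset.card_univ, Fintype.card_fin,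
      ← Real.exp_sum, ← Finset.mul_sum, hκ, one_div_pow]
  have hmeas : Measurable fun d : Fin (2 * p) → ℂ =>
      ENNReal.ofReal (∏ k, complexGaussianDensity σ (d k)) := by
    unfold complexGaussianDensity; fun_prop
  have hcount := aemeasurable_eigenvalueCount hp hA
  have hE : ∫⁻ ω, eigenvalueCount A (fun k => ε k ω) ∂P = ENNReal.ofReal κ *
      ((p.factorial : ENNReal)⁻¹ * ∑ i : Fin p, ∫⁻ z in A, kernelMass i 0 σ z) := by
    have hac : P.map (fun ω k => ε k ω) ≪ volume := by
      rw [hmap]; exact withDensity_absolutelyContinuous _ _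
    rw [← lintegral_map' (hcount.mono_ac hac) (aemeasurable_pi_lambda _ hε), hmap,
      lintegral_withDensity_eq_lintegral_mul₀ hmeas.aemeasurable hcount,
      ← lintegral_eigenvalueCount_mul hp σ hA, ← lintegral_const_mul' _ _ ENNReal.ofReal_ne_top]
    refine lintegral_congr fun d => ?_
    simp only [Pi.mul_apply]
    rw [hdens]
    ring
  have hker : ∀ (i : Fin p) z, ENNReal.ofReal κ * kernelMass i 0 σ z =
      ENNReal.ofReal (marginalDensity j 0 z 1) := by
    intro i z
    rw [marginalDensity_index j i, ← marginalDensity_zero_scale i z hσ,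
      marginalDensity_eq_kernelMass hp i 0 z hσ, ENNReal.ofReal_mul hκ0.le,
      ENNReal.ofReal_toReal (kernelMass_lt_top hp i hσ z).ne]
  have hE' : ∫⁻ ω, eigenvalueCount A (fun k => ε k ω) ∂P =
      (p.factorial : ENNReal)⁻¹ * (p * ∫⁻ z in A, ENNReal.ofReal (marginalDensity j 0 z 1)) := by
    rw [hE, mul_left_comm, Finset.mul_sum]
    congr 1
    have : ∀ i : Fin p, ENNReal.ofReal κ * ∫⁻ z in A, kernelMass i 0 σ z =
        ∫⁻ z in A, ENNReal.ofReal (marginalDensity j 0 z 1) := by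
      intro i
      rw [← lintegral_const_mul' _ _ ENNReal.ofReal_ne_top]
      exact lintegral_congr fun z => hker i z
    simp [this]
  have hgoal : ∫⁻ ω, ((generalizedEigenvalues (hankelOne fun k => ε k ω)
      (hankelZero fun k => ε k ω)).map fun x => Measure.dirac x).sum A ∂P =
      ∫⁻ ω, eigenvalueCount A (fun k => ε k ω) ∂P := rfl
  rw [hgoal, hE', mul_left_comm (p.factorial : ENNReal)⁻¹, ← mul_assoc,
    ENNReal.inv_mul_cancel (by exact_mod_cast hp.ne') (ENNReal.natCast_ne_top _), one_mul,
    ← lintegral_const_mul' _ _ (ENNReal.inv_ne_top.2 (by exact_mod_cast p.factorial_ne_zero))]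
  refine lintegral_congr fun z => ?_
  dsimp only
  rw [div_eq_inv_mul, ENNReal.ofReal_mul (by positivity),
    ENNReal.ofReal_inv_of_pos (by positivity), ENNReal.ofReal_natCast]

end Noise

theorem corollary1p7 {Ω : Type*} [MeasurableSpace Ω] (P : Measure Ω) [IsProbabilityMeasure P]
    (p : ℕ) (hp : 2 < 2 * p) (q : ℕ) (hq : q ≤ p) (c ξ : Fin q → ℂ) :
    -- the coefficients `β_h` exist, are unique, and `β_{n/2}` does not depend on the signal
    (∀ (j : Fin p) (ζ : {h : Fin p // h ≠ j} → ℂ) (z : ℂ), detD j ζ z ≠ 0 →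
      (∀ b, IsMomentExpansion j (expSignal p c ξ) ζ z b ↔ b = coeffBeta j (expSignal p c ξ) ζ z) ∧
      coeffBeta j (expSignal p c ξ) ζ z (Fin.last p) = coeffBeta j 0 ζ z (Fin.last p)) ∧
    -- the integrals converge
    (∀ (j : Fin p) (z : ℂ) (σ : ℝ), 0 < σ →
      Integrable (fun x : ({h : Fin p // h ≠ j} → ℂ) × (Fin p → ℂ) =>
        marginalIntegrand j (expSignal p c ξ) z σ x.1 x.2)) ∧
    (∀ z : ℂ, Integrable (limitIntegrand (⟨0, by omega⟩ : Fin p) (expSignal p c ξ) z)) ∧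
    -- all `h_n^{(j)}(z, σ)` have the same explicit limit as `σ → ∞`, independent of the signal
    (∀ (j : Fin p) (z : ℂ),
      Tendsto (fun σ : ℝ => marginalDensity j (expSignal p c ξ) z σ) atTop
        (𝓝 (limitDensity (⟨0, by omega⟩ : Fin p) (expSignal p c ξ) z))) ∧
    (∀ z : ℂ, limitDensity (⟨0, by omega⟩ : Fin p) (expSignal p c ξ) z =
      limitDensity (⟨0, by omega⟩ : Fin p) 0 z) ∧
    -- pure noise: `s = 0`, i.e. `c = 0`
    (Function.Injective ξ → (expSignal p c ξ = 0 ↔ c = 0)) ∧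
    (expSignal p c ξ = 0 → ∀ σ : ℝ, 0 < σ →
      (∀ (j : Fin p) (z : ℂ), marginalDensity j (expSignal p c ξ) z σ =
        limitDensity (⟨0, by omega⟩ : Fin p) (expSignal p c ξ) z) ∧
      (∀ z : ℂ, meanDensity (expSignal p c ξ) z σ =
        limitDensity (⟨0, by omega⟩ : Fin p) (expSignal p c ξ) z) ∧
      ∀ ε : Fin (2 * p) → Ω → ℂ,
        (∀ k, AEMeasurable (ε k) P) → iIndepFun ε P →
        (∀ k, P.map (ε k) = complexGaussian σ) →
        IsCondensedDensity P (fun ω k => expSignal p c ξ k + ε k ω)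
          (fun z => limitDensity (⟨0, by omega⟩ : Fin p) (expSignal p c ξ) z /
            (Nat.factorial p : ℝ))) ∧
    -- circular symmetry
    (∃ φ : ℝ → ℝ, ∀ z : ℂ,
      limitDensity (⟨0, by omega⟩ : Fin p) (expSignal p c ξ) z = φ (‖z‖ ^ 2)) := by

  have hp0 : 0 < p := by omega
  refine ⟨fun j ζ z hD => ⟨fun b => isMomentExpansion_iff _ hD b, ?_⟩,
    fun j z σ hσ => integrable_marginalIntegrand hp0 j _ z hσ,
    fun z => integrable_limitIntegrand hp0 _ _ z, fun j z => ?_, fun z => ?_,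
    expSignal_eq_zero_iff hq c ξ, fun h0 σ hσ => ?_, ?_⟩
  · rw [coeffBeta_last _ hD, coeffBeta_last _ hD]
  · rw [limitDensity_eq, marginalDensity_index _ j]
    exact tendsto_marginalDensity hp0 j _ z
  · rw [limitDensity_eq, limitDensity_eq]
  · have hm : ∀ (j : Fin p) (z : ℂ), marginalDensity j (expSignal p c ξ) z σ =
        limitDensity (⟨0, by omega⟩ : Fin p) (expSignal p c ξ) z := by
      intro j z
      rw [limitDensity_eq, h0, marginalDensity_zero_scale j z hσ, marginalDensity_index]
    refine ⟨hm, fun z => ?_, fun ε hε hindep hlaw => ?_⟩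
    · simp_rw [meanDensity, hm]
      have : (p : ℝ) ≠ 0 := by exact_mod_cast hp0.ne'
      simp only [Finset.sum_const, Finset.card_univ, Fintype.card_fin, nsmul_eq_mul]
      push_cast
      field_simp
    · simp_rw [limitDensity_eq, h0, Pi.zero_apply, zero_add]
      exact isCondensedDensity_noise P hp0 _ hσ ε hε hindep hlaw
  · refine ⟨fun r => marginalDensity (⟨0, by omega⟩ : Fin p) 0 (√r : ℂ) 1, fun z => ?_⟩
    dsimp only
    rw [limitDensity_eq, marginalDensity_eq_of_norm, Real.sqrt_sq (norm_nonneg z)]
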